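/- Let $(M,\langle\cdot,\cdot\rangle)$ be a Lorentzian manifold with Levi-Civita connection $\nabla$ and two commuting Killing vector fields $\mathcal K_t,\mathcal K_\varphi$ such that, with $\mathcal G_{\alpha\beta}=\langle\mathcal K_\alpha,\mathcal K_\beta\rangle$, $\det(\mathcal G_{\alpha\beta})<0$. For a constant $\rho\in\mathbb R$ put $\hat\rho=\rho\,\mathcal K_t+\mathcal K_\varphi$, and write $\|X\|=\sqrt{|\langle X,X\rangle|}$. Let $S\subset M$ be an isometrically embedded Lorentzian submanifold with second fundamental form ${\rm II}$, the component of $\nabla_XY$ normal to $S$, such that * $S$ is invariant: $\mathcal K_t$, $\mathcal K_\varphi$ and $[\mathcal K_t,\mathcal K_\varphi]$ are tangent to $S$; * $S$ is totally $\hat\rho^\perp$ umbilic: there is a field ${\rm H}$ of vectors normal to $S$ with ${\rm II}(X,Y)={\rm H}\,\langle X,Y\rangle$ for all $X,Y\in TS$ orthogonal to $\hat\rho$. Let $\hat\omega=\mathcal K_t+\omega\,\mathcal K_\varphi$ with a smooth function $\omega$ on $M$, and let $\Sigma\subset M$ be a spatial slice: an embedded spacelike submanifold to which $\mathcal K_\varphi$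 is tangent and whose tangent spaces are the orthogonal complements of $\hat\omega$. Let $S'=S\cap\Sigma$ be the spatial section of $S$, an embedded submanifold of $\Sigma$ with $\dim S'=\dim S-1$, and let ${\rm II}'$ be its second fundamental form as a submanifold of $\Sigma$ (with the induced metric and its Levi-Civita connection). Assume that, at the points of $S'$, ${\rm II}(\mathcal K_\varphi,X)=0$ for all $X\in TS$ orthogonal to $\mathcal K_t$ and $\mathcal K_\varphi$. For a function $f$ near a point of $S$ put $\nabla^\perp f=\sum_A\epsilon_A(\nabla_{\xi_A}f)\,\xi_A$, $\epsilon_A=\langle\xi_A,\xi_A\rangle$, where $\{\xi_A\}$ is any orthonormal frame of the normal space of $S$ there. A vector $\lambda$ tangent to $\Sigma$ and normal to $S'$ is called a principal curvature of $S'$ in the direction $u\in TS'$, $u\ne0$, if ${\rm II}'(u,v)=\lambda\,\langle u,v\rangle$ for all $v\in TS'$. Then at every point of $S'$ the vectors $$\lambda_\varphi=-\tfrac12\nabla^\perp\ln\mathcal G_{\varphi\varphi},\qquad \lambda_a={\rm H}$$ are tangent to $\Sigma$. $\lambda_\varphi$ is the principal curvature of $S'$ in the direction $\mathcal K_\varphi$,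 $\lambda_a$ is the principal curvature in every nonzero direction of $TS'$ orthogonal to $\mathcal K_t,\mathcal K_\varphi$, and every principal curvature of $S'$ is equal to $\lambda_\varphi$ or $\lambda_a$. Moreover, wherever $\langle\hat\rho,\hat\rho\rangle\neq0$ (in particular in the accessible region $\langle\hat\rho,\hat\rho\rangle>0$), $$\lambda_a-\lambda_\varphi=\nabla^\perp\ln\bigl(\|\hat\rho\|/\|\hat\omega\|\bigr).$$ -/

import Mathlib

open scoped Manifold ContDiff

noncomputable section

/-- A smooth pseudo-Riemannian metric on a manifold without boundary modelled on `E`. -/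
structure PseudoRiemMetric (E : Type*) [NormedAddCommGroup E] [NormedSpace ℝ E]
    (M : Type*) [TopologicalSpace M] [ChartedSpace E M] [IsManifold 𝓘(ℝ, E) ∞ M] where
  /-- The scalar product on each tangent space. -/
  val (x : M) : TangentSpace 𝓘(ℝ, E) x →L[ℝ] TangentSpace 𝓘(ℝ, E) x →L[ℝ] ℝ
  symm (x : M) (u v : TangentSpace 𝓘(ℝ, E) x) : val x u v = val x v u
  nondegenerate (x : M) (u : TangentSpace 𝓘(ℝ, E) x) (hu : ∀ v, val x u v = 0) : u = 0
  contMDiff : ContMDiff 𝓘(ℝ, E) (𝓘(ℝ, E).prod 𝓘(ℝ, E →L[ℝ] E →L[ℝ] ℝ)) ∞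
    (fun x ↦ Bundle.TotalSpace.mk' (E →L[ℝ] E →L[ℝ] ℝ) (E := fun x : M ↦
      TangentSpace 𝓘(ℝ, E) x →L[ℝ] TangentSpace 𝓘(ℝ, E) x →L[ℝ] ℝ) x (val x))

section Metric

variable {E : Type*} [NormedAddCommGroup E] [NormedSpace ℝ E]
  {M : Type*} [TopologicalSpace M] [ChartedSpace E M] [IsManifold 𝓘(ℝ, E) ∞ M]

/-- The metric has Lorentzian signature `(-, +, …, +)` at every point. -/
def PseudoRiemMetric.IsLorentzian (g : PseudoRiemMetric E M) : Prop :=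
  ∀ x, ∃ u, g.val x u u < 0 ∧ ∀ v, g.val x u v = 0 → v ≠ 0 → 0 < g.val x v v

/-- The metric is positive definite at every point. -/
def PseudoRiemMetric.IsRiemannian (g : PseudoRiemMetric E M) : Prop :=
  ∀ x (v : TangentSpace 𝓘(ℝ, E) x), v ≠ 0 → 0 < g.val x v v

/-- The norm `‖X‖ = √|⟨X, X⟩|` of a vector field, as a function on the manifold. -/
def PseudoRiemMetric.norm (g : PseudoRiemMetric E M) (X : Π x : M, TangentSpace 𝓘(ℝ, E) x) (x : M) : ℝ :=
  Real.sqrt |g.val x (X x) (X x)|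

/-- The orthogonal complement of a subspace of a tangent space. -/
def PseudoRiemMetric.orth (g : PseudoRiemMetric E M) {x : M}
    (W : Submodule ℝ (TangentSpace 𝓘(ℝ, E) x)) : Submodule ℝ (TangentSpace 𝓘(ℝ, E) x) :=
  LinearMap.BilinForm.orthogonal (g.val x).toBilinForm W

open Classical in
/-- The component in `W^⊥` of a vector in the decomposition `T_x M = W ⊕ W^⊥`, for a subspace `W`
on which the metric is nondegenerate (a junk value otherwise). -/
def PseudoRiemMetric.normalPart (g : PseudoRiemMetric E M) {x : M}
    (W : Submodule ℝ (TangentSpace 𝓘(ℝ, E) x)) (w : TangentSpace 𝓘(ℝ, E) x) :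
    TangentSpace 𝓘(ℝ, E) x :=
  if h : IsCompl (g.orth W) W then (g.orth W).projection W h w else 0

/-- Smoothness of a vector field. -/
def IsSmoothField (X : Π x : M, TangentSpace 𝓘(ℝ, E) x) : Prop :=
  ContMDiff 𝓘(ℝ, E) 𝓘(ℝ, E).tangent ∞ (fun x ↦ (⟨x, X x⟩ : TangentBundle 𝓘(ℝ, E) M))

/-- Differentiability of a vector field at a point. -/
def IsDiffFieldAt (X : Π x : M, TangentSpace 𝓘(ℝ, E) x) (x : M) : Prop :=
  MDifferentiableAt 𝓘(ℝ, E) 𝓘(ℝ, E).tangent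
    (fun x ↦ (⟨x, X x⟩ : TangentBundle 𝓘(ℝ, E) M)) x

/-- A connection on the tangent bundle; `D Y x u` is `∇_u Y` at `x`. -/
abbrev TangentConnection (E : Type*) [NormedAddCommGroup E] [NormedSpace ℝ E]
    (M : Type*) [TopologicalSpace M] [ChartedSpace E M] [IsManifold 𝓘(ℝ, E) ∞ M] :=
  CovariantDerivative 𝓘(ℝ, E) E (fun x : M ↦ TangentSpace 𝓘(ℝ, E) x)

/-- `D` is the Levi-Civita connection of `g`: it is torsion free and compatible with `g`. -/
structure IsLeviCivita [FiniteDimensional ℝ E] (g : PseudoRiemMetric E M)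
    (D : TangentConnection E M) : Prop where
  torsion_eq_zero : D.torsion = 0
  metric (X Y : Π x : M, TangentSpace 𝓘(ℝ, E) x) (x : M)
    (hX : IsDiffFieldAt X x) (hY : IsDiffFieldAt Y x) (u : TangentSpace 𝓘(ℝ, E) x) :
    mvfderiv 𝓘(ℝ, E) (fun y ↦ g.val y (X y) (Y y)) x u =
      g.val x (D X x u) (Y x) + g.val x (X x) (D Y x u)

/-- A smooth vector field satisfying the Killing equation
`⟨∇_u K, v⟩ + ⟨u, ∇_v K⟩ = 0`, where `D` is the Levi-Civita connection of `g`. -/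
structure IsKilling (g : PseudoRiemMetric E M) (D : TangentConnection E M)
    (K : Π x : M, TangentSpace 𝓘(ℝ, E) x) : Prop where
  smooth : IsSmoothField K
  killing (x : M) (u v : TangentSpace 𝓘(ℝ, E) x) :
    g.val x (D K x u) v + g.val x u (D K x v) = 0

/-- Two commuting Killing fields `Kt`, `Kφ` whose Gram determinant is negative everywhere. -/
structure IsStationaryAxisymmetric (g : PseudoRiemMetric E M) (D : TangentConnection E M)
    (Kt Kφ : Π x : M, TangentSpace 𝓘(ℝ, E) x) : Prop where
  killing_t : IsKilling g D Kt
  killing_φ : IsKilling g D Kφ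
  commute (x : M) : VectorField.mlieBracket 𝓘(ℝ, E) Kt Kφ x = 0
  gram_neg (x : M) :
    g.val x (Kt x) (Kt x) * g.val x (Kφ x) (Kφ x) - g.val x (Kt x) (Kφ x) ^ 2 < 0

/-- The Killing field `ρ̂ = ρ Kt + Kφ` of the constant `ρ`. -/
def rhoHat (Kt Kφ : Π x : M, TangentSpace 𝓘(ℝ, E) x) (ρ : ℝ) (x : M) : TangentSpace 𝓘(ℝ, E) x :=
  ρ • Kt x + Kφ x

/-- The vector field `ω̂ = Kt + om Kφ` of the function `om`. -/
def omegaHat (Kt Kφ : Π x : M, TangentSpace 𝓘(ℝ, E) x) (om : M → ℝ) (x : M) :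
    TangentSpace 𝓘(ℝ, E) x :=
  Kt x + om x • Kφ x

end Metric

section Submanifold

variable {E : Type*} [NormedAddCommGroup E] [NormedSpace ℝ E]
  {M : Type*} [TopologicalSpace M] [ChartedSpace E M] [IsManifold 𝓘(ℝ, E) ∞ M]
  {F : Type*} [NormedAddCommGroup F] [NormedSpace ℝ F]
  {S : Type*} [TopologicalSpace S] [ChartedSpace F S] [IsManifold 𝓘(ℝ, F) ∞ S]

/-- The differential of `f : S → M` at `q`. -/
abbrev diffl (f : S → M) (q : S) :
    TangentSpace 𝓘(ℝ, F) q →L[ℝ] TangentSpace 𝓘(ℝ, E) (f q) :=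
  mfderiv 𝓘(ℝ, F) 𝓘(ℝ, E) f q

variable (F) in
/-- The tangent space of the submanifold `f : S → M` at its point `f q`, as a subspace of
`T_{f q} M`. -/
abbrev tangentRange (f : S → M) (q : S) : Submodule ℝ (TangentSpace 𝓘(ℝ, E) (f q)) :=
  (diffl (F := F) f q).range

variable (F) in
/-- The subspace of `T_x M` consisting of the vectors tangent to the submanifold `f : S → M`
at its point `x` (the image of the differential of `f` in `T_x M`). -/
def tangentAt (f : S → M) (x : M) : Submodule ℝ (TangentSpace 𝓘(ℝ, E) x) :=
  Submodule.span ℝ {w | ∃ v : TangentBundle 𝓘(ℝ, F) S,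
    tangentMap 𝓘(ℝ, F) 𝓘(ℝ, E) f v = (⟨x, w⟩ : TangentBundle 𝓘(ℝ, E) M)}

/-- A smooth isometric embedding of `(S, h)` into `(M, g)`. -/
structure IsIsometricEmbedding (h : PseudoRiemMetric F S) (g : PseudoRiemMetric E M) (f : S → M) :
    Prop where
  embedding : Manifold.IsSmoothEmbedding 𝓘(ℝ, F) 𝓘(ℝ, E) ∞ f
  isometric (q : S) (u v : TangentSpace 𝓘(ℝ, F) q) :
    h.val q u v = g.val (f q) (diffl f q u) (diffl f q v)

/-- The covariant derivative `∇_u V` at `q` of a vector field `V` along `f : S → M`, for the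
connection `D` of `M`: in the trivialization of `TM` around `f q` one differentiates the
components of `V` and adds `∇_{df(u)}` of the field with constant components extending `V q`. -/
def covDerivAlong (D : TangentConnection E M) (f : S → M)
    (V : Π q : S, TangentSpace 𝓘(ℝ, E) (f q)) (q : S) (u : TangentSpace 𝓘(ℝ, F) q) :
    TangentSpace 𝓘(ℝ, E) (f q) :=
  (trivializationAt E (TangentSpace 𝓘(ℝ, E) : M → Type _) (f q)).symmL ℝ (f q)
      (mvfderiv 𝓘(ℝ, F) (fun q' ↦
        (trivializationAt E (TangentSpace 𝓘(ℝ, E) : M → Type _) (f q)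
          (⟨f q', V q'⟩ : TangentBundle 𝓘(ℝ, E) M)).2) q u)
    + D (FiberBundle.extend E (V q)) (f q) (diffl f q u)

/-- The second fundamental form `II(u, v) ∈ TS^⊥` of the submanifold `f : S → M` at `q`: the
component normal to `S` of `∇_u V`, for a vector field `V` on `S` extending `v`. -/
def secondFundamentalForm (g : PseudoRiemMetric E M) (D : TangentConnection E M) (f : S → M) (q : S)
    (u v : TangentSpace 𝓘(ℝ, F) q) : TangentSpace 𝓘(ℝ, E) (f q) :=
  g.normalPart (tangentRange F f q)
    (covDerivAlong D f (fun q' ↦ diffl f q' (FiberBundle.extend F v q')) q u)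

variable (F) in
/-- The submanifold is invariant: the fields `Kt`, `Kφ` and their commutator are tangent to it. -/
structure IsInvariantSubmanifold (f : S → M) (Kt Kφ : Π x : M, TangentSpace 𝓘(ℝ, E) x) : Prop where
  tangent_t (q : S) : Kt (f q) ∈ tangentRange F f q
  tangent_φ (q : S) : Kφ (f q) ∈ tangentRange F f q
  tangent_bracket (q : S) :
    VectorField.mlieBracket 𝓘(ℝ, E) Kt Kφ (f q) ∈ tangentRange F f q

variable (F) in
/-- The submanifold `f : S → M` is totally umbilic with respect to the subbundle
`R^⊥ ∩ TS` of `TS`, with mean curvature `H`, a field of vectors normal to `S`.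
Here `H` is written as a section over `M`, of which only the values at points of `S` matter. -/
structure IsTotallyUmbilicOnPerp (g : PseudoRiemMetric E M) (D : TangentConnection E M) (f : S → M)
    (R H : Π x : M, TangentSpace 𝓘(ℝ, E) x) : Prop where
  normal (q : S) : H (f q) ∈ g.orth (tangentRange F f q)
  umbilic (q : S) (u v : TangentSpace 𝓘(ℝ, F) q)
    (hu : g.val (f q) (R (f q)) (diffl f q u) = 0)
    (hv : g.val (f q) (R (f q)) (diffl f q v) = 0) :
    secondFundamentalForm g D f q u v =
      g.val (f q) (diffl f q u) (diffl f q v) • H (f q)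

/-- `c` is the principal curvature (a vector normal to the submanifold) of `f : S → M` in the
principal direction `u`: `II(u, v) = ⟨u, v⟩ c` for all tangent vectors `v`. -/
structure IsPrincipalCurvature (g : PseudoRiemMetric E M) (D : TangentConnection E M) (f : S → M)
    (q : S) (u : TangentSpace 𝓘(ℝ, F) q) (c : TangentSpace 𝓘(ℝ, E) (f q)) : Prop where
  ne_zero : u ≠ 0
  normal : c ∈ g.orth (tangentRange F f q)
  eigen (v : TangentSpace 𝓘(ℝ, F) q) :
    secondFundamentalForm g D f q u v = g.val (f q) (diffl f q u) (diffl f q v) • c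

variable (F) in
/-- `ξ` is an orthonormal frame of the normal space `(T_x S)^⊥` of `f : S → M` at `x`. -/
structure IsNormalFrame (g : PseudoRiemMetric E M) (f : S → M) (x : M) {k : ℕ}
    (ξ : Fin k → TangentSpace 𝓘(ℝ, E) x) : Prop where
  unit (A : Fin k) : |g.val x (ξ A) (ξ A)| = 1
  orthogonal (A B : Fin k) (h : A ≠ B) : g.val x (ξ A) (ξ B) = 0
  span_eq : Submodule.span ℝ (Set.range ξ) = g.orth (tangentAt F f x)

/-- The normal derivative `∇^⊥ φ = ∑_A ε_A (∇_{ξ_A} φ) ξ_A`, `ε_A = ⟨ξ_A, ξ_A⟩`, of a function. -/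
def normalDeriv (g : PseudoRiemMetric E M) (x : M) {k : ℕ} (ξ : Fin k → TangentSpace 𝓘(ℝ, E) x)
    (φ : M → ℝ) : TangentSpace 𝓘(ℝ, E) x :=
  ∑ A, (g.val x (ξ A) (ξ A) * mvfderiv 𝓘(ℝ, E) φ x (ξ A)) • ξ A

/-- `κ : (S, h) → (M, g)` is a spatial slice of the stationary axisymmetric spacetime `M`: a
spacelike submanifold whose tangent space at every point is the orthogonal complement of the
vector field `W`, and to which the axial Killing field `Kφ` is tangent. -/
structure IsSpatialSlice (h : PseudoRiemMetric F S) (g : PseudoRiemMetric E M) (κ : S → M)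
    (Kφ W : Π x : M, TangentSpace 𝓘(ℝ, E) x) : Prop where
  embedding : IsIsometricEmbedding h g κ
  spacelike : h.IsRiemannian
  orthogonal (y : S) : tangentRange F κ y = g.orth (Submodule.span ℝ {W (κ y)})
  tangent_φ (y : S) : Kφ (κ y) ∈ tangentRange F κ y

end Submanifold

end

/-! Since S is invariant, `ω̂` is tangent to S, and `ω̂` spans the normal line of the slice. Hence
vectors normal to S are tangent to the slice, vectors normal to the slice are tangent to S, and by
the dimension hypothesis the tangent space of S' is the intersection of the other two. By the Gauss
formula, covariant differentiation in M and in the slice differ by a vector normal to the slice,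
hence tangent to S, so taking the part normal to S forgets the difference: the second fundamental
form of S' in the slice is the restriction of that of S in M (`gauss_formula`,
`modelDiff_modelSecondForm`).

On TS' the form is then block diagonal. A vector of TS' orthogonal to `Kφ` is also orthogonal to
`Kt`, because it is orthogonal to `ω̂`; thus it is orthogonal to `ρ̂`, and umbilicity gives the
eigenvalue `H` there. The mixed terms with `Kφ` vanish by hypothesis, so the remaining eigenvalue is
`II(Kφ, Kφ) / ⟨Kφ, Kφ⟩` (`eigen_of_umbilic`).

For Killing fields X, Y tangent to S and n normal to S, the Killing equation gives `n⟨X, Y⟩ = -2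
⟨II(X, Y), n⟩` (`mvfderiv_val_eq_modelSecondForm`). This identifies `λ_φ` and expresses the normal
derivatives of all Gram entries through II. Umbilicity on the vector of the Killing plane orthogonal
to `ρ̂` is one linear relation between these and `H`; the master equation is that relation
rearranged (`curvature_difference_eq`).

The geometry is reduced to calculus at one point, in charts: a connection is a derivative plus
Christoffel symbols, and II is the normal part of a Hessian plus a Christoffel term
(`covDerivAlong_diffl`, `modelSecondForm_eq_iff`). -/

open scoped Manifold ContDiff
open Topology Bundle

/-! ### Derivatives and vector fields in the chart at a point -/

section ChartCalculus

variable {E : Type*} [NormedAddCommGroup E] [NormedSpace ℝ E]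
  {M : Type*} [TopologicalSpace M] [ChartedSpace E M]
  {E' : Type*} [NormedAddCommGroup E'] [NormedSpace ℝ E']

theorem MDifferentiableAt.hasFDerivAt_comp_extChartAt_symm {f : M → E'} {x : M}
    (hf : MDifferentiableAt 𝓘(ℝ, E) 𝓘(ℝ, E') f x) :
    HasFDerivAt (f ∘ (extChartAt 𝓘(ℝ, E) x).symm) (mvfderiv 𝓘(ℝ, E) f x : E →L[ℝ] E')
      (extChartAt 𝓘(ℝ, E) x x) := by
  have h := hf.hasMFDerivAt.2
  simp only [writtenInExtChartAt, modelWithCornersSelf_coe, Set.range_id,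
    extChartAt_model_space_eq_id] at h
  exact hasFDerivWithinAt_univ.1 h

theorem hasMFDerivAt_of_eventuallyEq_comp_extChartAt [IsManifold 𝓘(ℝ, E) 1 M]
    {f : M → E'} {x : M} {F : E → E'}
    {F' : E →L[ℝ] E'} (h : f =ᶠ[𝓝 x] F ∘ extChartAt 𝓘(ℝ, E) x)
    (hF : HasFDerivAt F F' (extChartAt 𝓘(ℝ, E) x x)) :
    HasMFDerivAt 𝓘(ℝ, E) 𝓘(ℝ, E') f x F' := by
  have h1 : HasMFDerivAt 𝓘(ℝ, E) 𝓘(ℝ, E') (F ∘ extChartAt 𝓘(ℝ, E) x) x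
      (F'.comp (mfderiv 𝓘(ℝ, E) 𝓘(ℝ, E) (extChartAt 𝓘(ℝ, E) x) x)) :=
    hF.hasMFDerivAt.comp x (mdifferentiableAt_extChartAt (by simp)).hasMFDerivAt
  rw [mfderiv_extChartAt_self] at h1
  exact h1.congr_of_eventuallyEq h

theorem mvfderiv_of_eventuallyEq_comp_extChartAt [IsManifold 𝓘(ℝ, E) 1 M]
    {f : M → E'} {x : M} {F : E → E'}
    {F' : E →L[ℝ] E'} (h : f =ᶠ[𝓝 x] F ∘ extChartAt 𝓘(ℝ, E) x)
    (hF : HasFDerivAt F F' (extChartAt 𝓘(ℝ, E) x x)) :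
    mvfderiv 𝓘(ℝ, E) f x = F' := by
  have := (hasMFDerivAt_of_eventuallyEq_comp_extChartAt h hF).mfderiv
  unfold mvfderiv
  rw [this]
  rfl

theorem Filter.EventuallyEq.mvfderiv_eq {f f₁ : M → E'} {x : M} (h : f₁ =ᶠ[𝓝 x] f) :
    (mvfderiv 𝓘(ℝ, E) f₁ x : E →L[ℝ] E') = mvfderiv 𝓘(ℝ, E) f x := by
  have h1 := h.mfderiv_eq (I := 𝓘(ℝ, E)) (I' := 𝓘(ℝ, E'))
  ext w
  exact congrArg (fun L : E →L[ℝ] E' ↦ L w) h1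

theorem eventually_nhds_extChartAt {x : M} {P : E → M → Prop} :
    (∀ᶠ y in 𝓝 (extChartAt 𝓘(ℝ, E) x x), P y ((extChartAt 𝓘(ℝ, E) x).symm y)) ↔
      ∀ᶠ z in 𝓝 x, P (extChartAt 𝓘(ℝ, E) x z) z := by
  constructor
  · intro h
    have h2 := (continuousAt_extChartAt (I := 𝓘(ℝ, E)) x).eventually h
    filter_upwards [h2, extChartAt_source_mem_nhds (I := 𝓘(ℝ, E)) x] with z hz hz'
    rwa [PartialEquiv.left_inv _ hz'] at hz
  · intro h
    have h2 := (continuousAt_extChartAt_symm (I := 𝓘(ℝ, E)) x)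
    unfold ContinuousAt at h2
    rw [extChartAt_to_inv] at h2
    filter_upwards [h2.eventually h, extChartAt_target_mem_nhds (I := 𝓘(ℝ, E)) x] with z hz hz'
    rwa [PartialEquiv.right_inv _ hz'] at hz

variable [IsManifold 𝓘(ℝ, E) ∞ M]

/-- The vector `w` at `y` in the coordinates given by the chart at `x`. -/
noncomputable def tangentCoord (x y : M) (w : TangentSpace 𝓘(ℝ, E) y) : E :=
  (trivializationAt E (TangentSpace 𝓘(ℝ, E) : M → Type _) x
    (⟨y, w⟩ : TangentBundle 𝓘(ℝ, E) M)).2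

theorem tangentCoord_eq_continuousLinearMapAt {x y : M} (hy : y ∈ (chartAt E x).source)
    (w : TangentSpace 𝓘(ℝ, E) y) :
    tangentCoord x y w = (trivializationAt E (TangentSpace 𝓘(ℝ, E) : M → Type _)
      x).continuousLinearMapAt ℝ y w := by
  rw [Trivialization.continuousLinearMapAt_apply_of_mem]
  · rfl
  · simpa using hy

theorem tangentCoord_eq_mfderiv {x y : M} (hy : y ∈ (chartAt E x).source)
    (w : TangentSpace 𝓘(ℝ, E) y) :
    tangentCoord x y w = mfderiv 𝓘(ℝ, E) 𝓘(ℝ, E) (extChartAt 𝓘(ℝ, E) x) y w := by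
  rw [tangentCoord_eq_continuousLinearMapAt hy,
    TangentBundle.continuousLinearMapAt_trivializationAt hy]
  rfl

theorem tangentCoord_self (x : M) (w : TangentSpace 𝓘(ℝ, E) x) : tangentCoord x x w = w := by
  rw [tangentCoord_eq_mfderiv (by simp), mfderiv_extChartAt_self]
  rfl

/-- The vector at `y` with coordinates `w` in the chart at `x`. -/
noncomputable def coordVector (x y : M) : E →L[ℝ] TangentSpace 𝓘(ℝ, E) y :=
  (trivializationAt E (TangentSpace 𝓘(ℝ, E) : M → Type _) x).symmL ℝ y

theorem coordVector_self (x : M) (w : E) : coordVector x x w = w := by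
  rw [coordVector, TangentBundle.symmL_trivializationAt (by simp),
    mfderivWithin_range_extChartAt_symm]
  rfl

theorem coordVector_eq_mfderivWithin {x y : M} (hy : y ∈ (chartAt E x).source) (w : E) :
    coordVector x y w = mfderivWithin 𝓘(ℝ, E) 𝓘(ℝ, E) (extChartAt 𝓘(ℝ, E) x).symm
      (Set.range 𝓘(ℝ, E)) (extChartAt 𝓘(ℝ, E) x y) w := by
  rw [coordVector, TangentBundle.symmL_trivializationAt hy]
  rfl

theorem extend_eq_coordVector {x y : M} (hy : y ∈ (chartAt E x).source)
    (w : TangentSpace 𝓘(ℝ, E) x) :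
    FiberBundle.extend E w y = coordVector (E := E) x y w := by
  have h : tangentCoord x x w = w := tangentCoord_self x w
  have h2 : y ∈ (trivializationAt E (TangentSpace 𝓘(ℝ, E) : M → Type _) x).baseSet := by
    simpa using hy
  refine Eq.trans ?_ (congrArg (fun v : E ↦ coordVector (E := E) x y v) h)
  exact (Trivialization.symmL_apply (R := ℝ) _ h2 (tangentCoord x x w)).symm

theorem tangentCoord_coordVector {x y : M} (hy : y ∈ (chartAt E x).source) (w : E) :
    tangentCoord x y (coordVector x y w) = w := by
  rw [tangentCoord_eq_continuousLinearMapAt hy]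
  exact Trivialization.continuousLinearMapAt_symmL _ (by simpa using hy) w

theorem coordVector_tangentCoord {x y : M} (hy : y ∈ (chartAt E x).source)
    (w : TangentSpace 𝓘(ℝ, E) y) : coordVector x y (tangentCoord x y w) = w := by
  rw [tangentCoord_eq_continuousLinearMapAt hy]
  exact Trivialization.symmL_continuousLinearMapAt _ (by simpa using hy) w

theorem isDiffFieldAt_iff {X : Π x : M, TangentSpace 𝓘(ℝ, E) x} {x : M} :
    IsDiffFieldAt X x ↔
      MDifferentiableAt 𝓘(ℝ, E) 𝓘(ℝ, E) (fun y ↦ tangentCoord x y (X y)) x := by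
  unfold IsDiffFieldAt
  exact mdifferentiableAt_section (IB := 𝓘(ℝ, E)) X

theorem isDiffFieldAt_coordVector (x : M) (w : E) :
    IsDiffFieldAt (fun y ↦ coordVector x y w) x := by
  rw [isDiffFieldAt_iff]
  refine (mdifferentiableAt_const (c := w)).congr_of_eventuallyEq ?_
  filter_upwards [chart_source_mem_nhds E x] with y hy using tangentCoord_coordVector hy w

theorem tangentCoord_extend {x y : M} (hy : y ∈ (chartAt E x).source)
    (w : TangentSpace 𝓘(ℝ, E) x) : tangentCoord x y (FiberBundle.extend E w y) = w := by
  rw [extend_eq_coordVector hy]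
  exact tangentCoord_coordVector hy w

theorem isDiffFieldAt_extend {x : M} (w : TangentSpace 𝓘(ℝ, E) x) :
    IsDiffFieldAt (FiberBundle.extend E w) x := by
  rw [isDiffFieldAt_iff]
  have h : MDifferentiableAt 𝓘(ℝ, E) 𝓘(ℝ, E) (fun _ : M ↦ (id w : E)) x := mdifferentiableAt_const
  refine h.congr_of_eventuallyEq ?_
  filter_upwards [chart_source_mem_nhds E x] with y hy using tangentCoord_extend hy w

theorem IsSmoothField.isDiffFieldAt {X : Π x : M, TangentSpace 𝓘(ℝ, E) x}
    (hX : IsSmoothField X) (x : M) : IsDiffFieldAt X x :=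
  (ContMDiff.contMDiffAt hX).mdifferentiableAt (by simp)

end ChartCalculus

/-! ### Christoffel symbols of a connection -/

section Christoffel

variable {E : Type*} [NormedAddCommGroup E] [NormedSpace ℝ E]
  {M : Type*} [TopologicalSpace M] [ChartedSpace E M] [IsManifold 𝓘(ℝ, E) ∞ M]

/-- The connection for which the coordinate fields of the chart at `x` are parallel. -/
theorem isCovariantDerivativeOn_coord (x : M) :
    IsCovariantDerivativeOn (I := 𝓘(ℝ, E)) E (V := (TangentSpace 𝓘(ℝ, E) : M → Type _))
      (fun X y ↦ (coordVector x y).comp (mvfderiv 𝓘(ℝ, E) (fun z ↦ tangentCoord x z (X z)) y))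
      {x} where
  add {X Y y} hX hY hy := by
    obtain rfl : y = x := hy
    rw [← ContinuousLinearMap.comp_add,
      ← mvfderiv_add (isDiffFieldAt_iff.1 hX) (isDiffFieldAt_iff.1 hY)]
    refine congrArg (coordVector y y).comp (Filter.EventuallyEq.mvfderiv_eq ?_)
    filter_upwards [chart_source_mem_nhds E y] with z hz
    simp only [tangentCoord_eq_continuousLinearMapAt hz, Pi.add_apply, map_add]
  leibniz {X f y} hX hf hy := by
    obtain rfl : y = x := hy
    have h : (fun z ↦ tangentCoord y z ((f • X) z)) =ᶠ[𝓝 y]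
        f • fun z ↦ tangentCoord y z (X z) := by
      filter_upwards [chart_source_mem_nhds E y] with z hz
      simp only [tangentCoord_eq_continuousLinearMapAt hz, Pi.smul_apply', map_smul]
    ext w
    have h1 := congrArg (fun L : E →L[ℝ] E ↦ coordVector y y (L w)) h.mvfderiv_eq
    have h2 := mvfderiv_smul hf (isDiffFieldAt_iff.1 hX)
    refine h1.trans ?_
    rw [h2]
    have h3 := coordVector_tangentCoord (mem_chart_source E y) (X y)
    change coordVector y y (f y • (mvfderiv 𝓘(ℝ, E) (fun z ↦ tangentCoord y z (X z)) y w : E) +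
      (mvfderiv 𝓘(ℝ, E) f y w : ℝ) • tangentCoord y y (X y)) = _
    rw [map_add, map_smul, map_smul, h3]
    rfl

/-- The Christoffel symbols: in the chart at `x`, a connection at `x` is the derivative of the
components plus a bilinear map. -/
theorem TangentConnection.exists_christoffel [FiniteDimensional ℝ E] (D : TangentConnection E M) (x : M) :
    ∃ Γ : E →L[ℝ] E →L[ℝ] E, ∀ X : Π x : M, TangentSpace 𝓘(ℝ, E) x, IsDiffFieldAt X x →
      ∀ w : E, D X x w = mvfderiv 𝓘(ℝ, E) (fun y ↦ tangentCoord x y (X y)) x w + Γ (X x) w := by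
  -- The difference of two connections is tensorial, so it depends only on the value of the field at
  -- `x`.
  refine ⟨(D.isCovariantDerivativeOn.difference (isCovariantDerivativeOn_coord x) x :), ?_⟩
  intro X hX w
  have h := IsCovariantDerivativeOn.difference_apply (D.isCovariantDerivativeOn)
    (isCovariantDerivativeOn_coord x) (by simp) hX
  have h2 := congrArg (fun L : E →L[ℝ] E ↦ L w) h
  have h3 : D X x w - coordVector (E := E) x x
      (mvfderiv 𝓘(ℝ, E) (fun z ↦ tangentCoord x z (X z)) x w) = _ := h2.symm
  rw [coordVector_self] at h3
  exact eq_add_of_sub_eq' h3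

end Christoffel

/-! ### The Levi-Civita connection and the metric in a chart -/

section LeviCivita

variable {E : Type*} [NormedAddCommGroup E] [NormedSpace ℝ E]
  {M : Type*} [TopologicalSpace M] [ChartedSpace E M] [IsManifold 𝓘(ℝ, E) ∞ M]

theorem mvfderiv_tangentCoord_coordVector (x : M) (v : E) :
    mvfderiv 𝓘(ℝ, E) (fun y ↦ tangentCoord x y (coordVector x y v)) x = 0 := by
  have h : (fun y ↦ tangentCoord x y (coordVector x y v)) =ᶠ[𝓝 x] fun _ ↦ v := by
    filter_upwards [chart_source_mem_nhds E x] with y hy using tangentCoord_coordVector hy v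
  exact h.mvfderiv_eq.trans (mvfderiv_const _)

/-- Pulled back through the chart, coordinate fields are constant, so their bracket vanishes. -/
theorem mlieBracket_coordVector [CompleteSpace E] (x : M) (a b : E) :
    VectorField.mlieBracket 𝓘(ℝ, E) (fun y ↦ coordVector x y a) (fun y ↦ coordVector x y b) x
      = 0 := by
  have key : ∀ a : E, VectorField.mpullbackWithin 𝓘(ℝ, E) 𝓘(ℝ, E) (extChartAt 𝓘(ℝ, E) x).symm
      (fun y ↦ coordVector x y a) (Set.range 𝓘(ℝ, E)) =ᶠ[𝓝 (extChartAt 𝓘(ℝ, E) x x)]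
      fun _ ↦ a := by
    intro a
    filter_upwards [extChartAt_target_mem_nhds (I := 𝓘(ℝ, E)) x] with y hy
    have h1 : (extChartAt 𝓘(ℝ, E) x).symm y ∈ (chartAt E x).source := by
      have := (extChartAt 𝓘(ℝ, E) x).map_target hy
      rwa [extChartAt_source] at this
    rw [VectorField.mpullbackWithin_apply, coordVector_eq_mfderivWithin h1,
      PartialEquiv.right_inv _ hy]
    have h2 := (isInvertible_mfderivWithin_extChartAt_symm (I := 𝓘(ℝ, E)) hy)
    exact h2.inverse_apply_eq.2 rfl
  rw [VectorField.mlieBracket, VectorField.mlieBracketWithin_apply]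
  have h3 : (VectorField.lieBracketWithin ℝ
      (VectorField.mpullbackWithin 𝓘(ℝ, E) 𝓘(ℝ, E) (extChartAt 𝓘(ℝ, E) x).symm
        (fun y ↦ coordVector x y a) (Set.range 𝓘(ℝ, E)))
      (VectorField.mpullbackWithin 𝓘(ℝ, E) 𝓘(ℝ, E) (extChartAt 𝓘(ℝ, E) x).symm
        (fun y ↦ coordVector x y b) (Set.range 𝓘(ℝ, E)))
      ((extChartAt 𝓘(ℝ, E) x).symm ⁻¹' Set.univ ∩ Set.range 𝓘(ℝ, E)))
      (extChartAt 𝓘(ℝ, E) x x) = 0 := by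
    simp only [Set.preimage_univ, Set.univ_inter]
    have h4 := (key a).lieBracketWithin_vectorField_eq_nhds (𝕜 := ℝ) (s := Set.range 𝓘(ℝ, E))
      (key b)
    refine h4.trans ?_
    simp [VectorField.lieBracketWithin]
  rw [h3]
  exact map_zero (mfderiv 𝓘(ℝ, E) 𝓘(ℝ, E) (extChartAt 𝓘(ℝ, E) x) x).inverse

/-- Vanishing torsion, tested on coordinate fields, whose bracket is zero, is exactly the symmetry
of `Γ`. -/
theorem IsLeviCivita.exists_christoffel [FiniteDimensional ℝ E] {g : PseudoRiemMetric E M}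
    {D : TangentConnection E M} (hD : IsLeviCivita g D) (x : M) :
    ∃ Γ : E →L[ℝ] E →L[ℝ] E, (∀ a b, Γ a b = Γ b a) ∧
      ∀ X : Π x : M, TangentSpace 𝓘(ℝ, E) x, IsDiffFieldAt X x →
      ∀ w : E, D X x w = mvfderiv 𝓘(ℝ, E) (fun y ↦ tangentCoord x y (X y)) x w + Γ (X x) w := by
  obtain ⟨Γ, hΓ⟩ := D.exists_christoffel x
  refine ⟨Γ, fun a b ↦ ?_, hΓ⟩
  have h : ∀ v w : E, D (fun y ↦ coordVector x y v) x w = Γ v w := by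
    intro v w
    rw [hΓ _ (isDiffFieldAt_coordVector x v) w, mvfderiv_tangentCoord_coordVector,
      coordVector_self]
    exact zero_add _
  have h1 := D.torsion_eq_zero_iff.1 hD.torsion_eq_zero (isDiffFieldAt_coordVector x a)
    (isDiffFieldAt_coordVector x b)
  rw [mlieBracket_coordVector, coordVector_self, coordVector_self] at h1
  have h2 := (h b a).symm.trans ((sub_eq_zero.1 h1).trans (h a b))
  exact h2.symm

/-- The scalar product on a tangent space, as a bilinear form on the model space. -/
noncomputable def PseudoRiemMetric.form (g : PseudoRiemMetric E M) (x : M) :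
    E →L[ℝ] E →L[ℝ] ℝ := g.val x

theorem PseudoRiemMetric.form_symm (g : PseudoRiemMetric E M) (x : M) (u v : E) :
    g.form x u v = g.form x v u := g.symm x u v

/-- The metric in the chart at `x`. -/
noncomputable def PseudoRiemMetric.inChart (g : PseudoRiemMetric E M) (x : M) (y : E) :
    E →L[ℝ] E →L[ℝ] ℝ :=
  ContinuousLinearMap.inCoordinates E (TangentSpace 𝓘(ℝ, E) : M → Type _) (E →L[ℝ] ℝ)
    (fun y : M ↦ TangentSpace 𝓘(ℝ, E) y →L[ℝ] ℝ) x ((extChartAt 𝓘(ℝ, E) x).symm y) x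
    ((extChartAt 𝓘(ℝ, E) x).symm y) (g.val ((extChartAt 𝓘(ℝ, E) x).symm y))

theorem PseudoRiemMetric.inChart_extChartAt (g : PseudoRiemMetric E M) {x y : M}
    (hy : y ∈ (chartAt E x).source) (a b : E) :
    g.inChart x (extChartAt 𝓘(ℝ, E) x y) a b =
      g.val y (coordVector x y a) (coordVector x y b) := by
  unfold inChart
  rw [PartialEquiv.left_inv _ (by simpa using hy)]
  have := inCoordinates_apply_eq₂ (F₁ := E) (F₂ := E) (F₃ := ℝ)
    (E₁ := (TangentSpace 𝓘(ℝ, E) : M → Type _)) (E₂ := (TangentSpace 𝓘(ℝ, E) : M → Type _))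
    (E₃ := fun _ ↦ ℝ) (x₀ := x) (x := y) (ϕ := g.val y)
    (v := a) (w := b) (by simpa using hy) (by simpa using hy) (by simp)
  refine this.trans ?_
  rw [coordVector, Trivialization.symmL_apply _ (by simpa using hy),
    Trivialization.symmL_apply _ (by simpa using hy)]
  simp

theorem PseudoRiemMetric.differentiableAt_inChart (g : PseudoRiemMetric E M) (x : M) :
    DifferentiableAt ℝ (g.inChart x) (extChartAt 𝓘(ℝ, E) x x) := by
  have h := (contMDiffAt_hom_bundle _).1 (g.contMDiff x)
  have h2 := h.2.mdifferentiableAt (by simp)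
  exact h2.hasFDerivAt_comp_extChartAt_symm.differentiableAt

theorem PseudoRiemMetric.inChart_extChartAt_self (g : PseudoRiemMetric E M) (x : M) :
    g.inChart x (extChartAt 𝓘(ℝ, E) x x) = g.form x := by
  ext a b
  rw [g.inChart_extChartAt (mem_chart_source E x), coordVector_self, coordVector_self]
  rfl

/-- This is metric compatibility tested on coordinate fields: their covariant derivatives at `x` are
given by `Γ` alone. -/
theorem IsLeviCivita.fderiv_inChart [FiniteDimensional ℝ E] {g : PseudoRiemMetric E M}
    {D : TangentConnection E M} (hD : IsLeviCivita g D) {x : M} {Γ : E →L[ℝ] E →L[ℝ] E}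
    (hΓ : ∀ X : Π x : M, TangentSpace 𝓘(ℝ, E) x, IsDiffFieldAt X x →
      ∀ w : E, D X x w = mvfderiv 𝓘(ℝ, E) (fun y ↦ tangentCoord x y (X y)) x w + Γ (X x) w)
    (w a b : E) :
    fderiv ℝ (g.inChart x) (extChartAt 𝓘(ℝ, E) x x) w a b =
      g.form x (Γ a w) b + g.form x a (Γ b w) := by
  have h : ∀ v w : E, D (fun y ↦ coordVector x y v) x w = Γ v w := by
    intro v w
    rw [hΓ _ (isDiffFieldAt_coordVector x v) w, mvfderiv_tangentCoord_coordVector,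
      coordVector_self]
    exact zero_add _
  have h1 := hD.metric _ _ x (isDiffFieldAt_coordVector x a) (isDiffFieldAt_coordVector x b) w
  rw [coordVector_self, coordVector_self] at h1
  rw [← h a w, ← h b w]
  refine Eq.trans ?_ h1
  have h2 : HasFDerivAt (fun y ↦ g.inChart x y a b) _ (extChartAt 𝓘(ℝ, E) x x) :=
    ((g.differentiableAt_inChart x).hasFDerivAt.clm_apply (hasFDerivAt_const a _)).clm_apply
      (hasFDerivAt_const b _)
  rw [mvfderiv_of_eventuallyEq_comp_extChartAt ?_ h2]
  · simp only [ContinuousLinearMap.comp_zero, zero_add]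
    rfl
  · filter_upwards [chart_source_mem_nhds E x] with y hy
    exact (g.inChart_extChartAt hy a b).symm

end LeviCivita

/-! ### First and second derivatives of maps between manifolds -/

section Maps

variable {E : Type*} [NormedAddCommGroup E] [NormedSpace ℝ E]
  {M : Type*} [TopologicalSpace M] [ChartedSpace E M] [IsManifold 𝓘(ℝ, E) ∞ M]
  {F : Type*} [NormedAddCommGroup F] [NormedSpace ℝ F]
  {S : Type*} [TopologicalSpace S] [ChartedSpace F S] [IsManifold 𝓘(ℝ, F) ∞ S]
  {F' : Type*} [NormedAddCommGroup F'] [NormedSpace ℝ F']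
  {S' : Type*} [TopologicalSpace S'] [ChartedSpace F' S'] [IsManifold 𝓘(ℝ, F') ∞ S']

variable (F E) in
/-- A map between manifolds, read in the charts at `q` and `f q`. -/
noncomputable def inCharts (f : S → M) (q : S) : F → E :=
  extChartAt 𝓘(ℝ, E) (f q) ∘ f ∘ (extChartAt 𝓘(ℝ, F) q).symm

variable (F E) in
/-- The second derivative of a map between manifolds, read in the charts at `q` and `f q`. -/
noncomputable def chartHessian (f : S → M) (q : S) : F →L[ℝ] F →L[ℝ] E :=
  fderiv ℝ (fderiv ℝ (inCharts E F f q)) (extChartAt 𝓘(ℝ, F) q q)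

variable (F E) in
/-- The differential of a map, as a map between the model spaces. -/
noncomputable def modelDiff (f : S → M) (q : S) : F →L[ℝ] E := mfderiv 𝓘(ℝ, F) 𝓘(ℝ, E) f q

omit [IsManifold 𝓘(ℝ, E) ∞ M] [IsManifold 𝓘(ℝ, F) ∞ S] in
theorem ContMDiff.contDiffAt_inCharts {f : S → M} (hf : ContMDiff 𝓘(ℝ, F) 𝓘(ℝ, E) ∞ f) (q : S) :
    ContDiffAt ℝ ∞ (inCharts E F f q) (extChartAt 𝓘(ℝ, F) q q) := by
  have h := (contMDiffAt_iff.1 (hf q)).2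
  simp only [modelWithCornersSelf_coe, Set.range_id, contDiffWithinAt_univ] at h
  exact h

omit [IsManifold 𝓘(ℝ, E) ∞ M] [IsManifold 𝓘(ℝ, F) ∞ S] in
theorem ContMDiff.fderiv_inCharts {f : S → M} (hf : ContMDiff 𝓘(ℝ, F) 𝓘(ℝ, E) ∞ f) (q : S) :
    fderiv ℝ (inCharts E F f q) (extChartAt 𝓘(ℝ, F) q q) = modelDiff E F f q := by
  have h := (hf.mdifferentiable (by simp) q).hasMFDerivAt.2
  simp only [modelWithCornersSelf_coe, Set.range_id] at h
  have h' : HasFDerivAt (inCharts E F f q) (modelDiff E F f q) _ := hasFDerivWithinAt_univ.1 h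
  exact h'.fderiv

theorem HasMFDerivAt.apply_eq_fderiv {G : F → E} {y : F}
    {L : TangentSpace 𝓘(ℝ, F) y →L[ℝ] TangentSpace 𝓘(ℝ, E) (G y)}
    (h : HasMFDerivAt 𝓘(ℝ, F) 𝓘(ℝ, E) G y L) (v : TangentSpace 𝓘(ℝ, F) y) :
    L v = (fderiv ℝ G y v : E) := by
  have h1 := h.mfderiv.symm.trans mfderiv_eq_fderiv
  exact congrArg (fun K : F →L[ℝ] E ↦ K v) h1

theorem ContMDiff.tangentCoord_mfderiv {f : S → M} (hf : ContMDiff 𝓘(ℝ, F) 𝓘(ℝ, E) ∞ f)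
    {q q' : S} (hq' : q' ∈ (chartAt F q).source) (hfq' : f q' ∈ (chartAt E (f q)).source) (v : F) :
    tangentCoord (f q) (f q') (diffl f q' (coordVector q q' v)) =
      fderiv ℝ (inCharts E F f q) (extChartAt 𝓘(ℝ, F) q q') v := by
  rw [tangentCoord_eq_mfderiv hfq', coordVector_eq_mfderivWithin hq']
  have h1 := (mdifferentiableAt_extChartAt (I := 𝓘(ℝ, E)) hfq').hasMFDerivAt
  have h2 := (hf.mdifferentiable (by simp) q').hasMFDerivAt
  have hy : extChartAt 𝓘(ℝ, F) q q' ∈ (extChartAt 𝓘(ℝ, F) q).target :=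
    (extChartAt 𝓘(ℝ, F) q).map_source (by simpa using hq')
  have h3 := (mdifferentiableWithinAt_extChartAt_symm (I := 𝓘(ℝ, F)) hy).hasMFDerivWithinAt
  have e : (extChartAt 𝓘(ℝ, F) q).symm (extChartAt 𝓘(ℝ, F) q q') = q' :=
    (extChartAt 𝓘(ℝ, F) q).left_inv (by simpa using hq')
  have h4 := h1.comp q' h2
  -- The base point is rewritten as the image of its coordinates, so that the inverse chart can be
  -- composed on the right.
  rw [← e] at h4
  have h5 := h4.comp_hasMFDerivWithinAt _ h3
  simp only [modelWithCornersSelf_coe, Set.range_id] at h5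
  rw [e] at h5
  have h6 : HasMFDerivAt 𝓘(ℝ, F) 𝓘(ℝ, E) (inCharts E F f q) _ _ := hasMFDerivWithinAt_univ.1 h5
  simp only [modelWithCornersSelf_coe, Set.range_id]
  exact h6.apply_eq_fderiv v

theorem ContMDiff.eventually_tangentCoord_diffl {f : S → M}
    (hf : ContMDiff 𝓘(ℝ, F) 𝓘(ℝ, E) ∞ f) (q : S) (v : F) :
    (fun q' ↦ tangentCoord (f q) (f q') (diffl f q' (coordVector q q' v))) =ᶠ[𝓝 q]
      (fun y ↦ fderiv ℝ (inCharts E F f q) y v) ∘ extChartAt 𝓘(ℝ, F) q := by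
  filter_upwards [chart_source_mem_nhds F q,
    hf.continuous.continuousAt.preimage_mem_nhds (chart_source_mem_nhds E (f q))] with q' h1 h2
  exact hf.tangentCoord_mfderiv h1 h2 v

omit [IsManifold 𝓘(ℝ, E) ∞ M] [IsManifold 𝓘(ℝ, F) ∞ S] in
theorem ContMDiff.hasFDerivAt_fderiv_inCharts {f : S → M}
    (hf : ContMDiff 𝓘(ℝ, F) 𝓘(ℝ, E) ∞ f) (q : S) :
    HasFDerivAt (fderiv ℝ (inCharts E F f q)) (chartHessian E F f q) (extChartAt 𝓘(ℝ, F) q q) :=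
  ((((hf.contDiffAt_inCharts q).of_le (m := 2) (WithTop.coe_le_coe.2 le_top)).fderiv_right
    (m := 1) (by norm_num)).differentiableAt (by simp)).hasFDerivAt

omit [IsManifold 𝓘(ℝ, E) ∞ M] [IsManifold 𝓘(ℝ, F) ∞ S] in
theorem ContMDiff.hasFDerivAt_fderiv_inCharts_apply {f : S → M}
    (hf : ContMDiff 𝓘(ℝ, F) 𝓘(ℝ, E) ∞ f) (q : S) (v : F) :
    HasFDerivAt (fun y ↦ fderiv ℝ (inCharts E F f q) y v) ((chartHessian E F f q).flip v)
      (extChartAt 𝓘(ℝ, F) q q) := by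
  have := (hf.hasFDerivAt_fderiv_inCharts q).clm_apply (hasFDerivAt_const v _)
  rwa [ContinuousLinearMap.comp_zero, zero_add] at this

omit [IsManifold 𝓘(ℝ, E) ∞ M] [IsManifold 𝓘(ℝ, F) ∞ S] in
theorem ContMDiff.chartHessian_symm {f : S → M}
    (hf : ContMDiff 𝓘(ℝ, F) 𝓘(ℝ, E) ∞ f) (q : S) (u v : F) :
    chartHessian E F f q u v = chartHessian E F f q v u :=
  ((hf.contDiffAt_inCharts q).isSymmSndFDerivAt (by simpa using WithTop.coe_le_coe.2 (le_top : (2 : ℕ∞) ≤ ⊤))) u v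

/-- The field extending `v` has constant components in the chart at `q`, so its image has components
`y ↦ df_y v`, with derivative the Hessian of `f`. The extension of its value at `f q` is again
constant in coordinates and contributes only `Γ`. -/
theorem covDerivAlong_diffl [FiniteDimensional ℝ E] {D : TangentConnection E M} {f : S → M}
    (hf : ContMDiff 𝓘(ℝ, F) 𝓘(ℝ, E) ∞ f) (q : S) {Γ : E →L[ℝ] E →L[ℝ] E}
    (hΓ : ∀ X : Π x : M, TangentSpace 𝓘(ℝ, E) x, IsDiffFieldAt X (f q) →
      ∀ w : E, D X (f q) w =
        mvfderiv 𝓘(ℝ, E) (fun y ↦ tangentCoord (f q) y (X y)) (f q) w + Γ (X (f q)) w)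
    (u v : TangentSpace 𝓘(ℝ, F) q) :
    covDerivAlong D f (fun q' ↦ diffl f q' (FiberBundle.extend F v q')) q u =
      (chartHessian E F f q u v + Γ (modelDiff E F f q v) (modelDiff E F f q u) : E) := by
  have h1 : (fun q' ↦ tangentCoord (f q) (f q') (diffl f q' (FiberBundle.extend F v q'))) =ᶠ[𝓝 q]
      (fun y ↦ fderiv ℝ (inCharts E F f q) y v) ∘ extChartAt 𝓘(ℝ, F) q := by
    refine Filter.EventuallyEq.trans ?_ (hf.eventually_tangentCoord_diffl q v)
    filter_upwards [chart_source_mem_nhds F q] with q' h1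
    rw [extend_eq_coordVector h1]
  have h2 := mvfderiv_of_eventuallyEq_comp_extChartAt h1
    (hf.hasFDerivAt_fderiv_inCharts_apply q v)
  have h3 : ∀ a b : TangentSpace 𝓘(ℝ, E) (f q),
      D (FiberBundle.extend E a) (f q) b = (Γ a b : E) := by
    intro a b
    rw [hΓ _ (isDiffFieldAt_extend _) b, FiberBundle.extend_apply_self]
    have h : (fun y ↦ tangentCoord (f q) y (FiberBundle.extend E a y)) =ᶠ[𝓝 (f q)]
        fun _ ↦ (id a : E) := by
      filter_upwards [chart_source_mem_nhds E (f q)] with y hy using tangentCoord_extend hy a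
    have h' := congrArg (fun L : E →L[ℝ] E ↦ L b) (h.mvfderiv_eq.trans (mvfderiv_const _))
    exact (congrArg (fun c : E ↦ c + Γ a b) h').trans (zero_add _)
  refine congrArg₂ (fun a b : E ↦ a + b) ?_ ?_
  · refine (coordVector_self (f q) _).trans ?_
    have h4 := congrArg (fun L : F →L[ℝ] E ↦ L u) h2
    exact h4
  · refine (h3 _ _).trans ?_
    exact congrArg (fun a : E ↦ Γ a (modelDiff E F f q u))
      (congrArg (diffl f q) (FiberBundle.extend_apply_self F v))

omit [IsManifold 𝓘(ℝ, E) ∞ M] [IsManifold 𝓘(ℝ, F) ∞ S] [IsManifold 𝓘(ℝ, F') ∞ S'] in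
theorem modelDiff_comp {f : S → M} (hf : ContMDiff 𝓘(ℝ, F) 𝓘(ℝ, E) ∞ f) {s : S' → S}
    (hs : ContMDiff 𝓘(ℝ, F') 𝓘(ℝ, F) ∞ s) (p : S') :
    modelDiff E F' (f ∘ s) p = (modelDiff E F f (s p)).comp (modelDiff F F' s p) :=
  mfderiv_comp p (hf.mdifferentiable (by simp) _) (hs.mdifferentiable (by simp) _)

omit [IsManifold 𝓘(ℝ, E) ∞ M] [IsManifold 𝓘(ℝ, F) ∞ S] [IsManifold 𝓘(ℝ, F') ∞ S'] in
-- The second term of this chain rule is tangent to `f`, hence invisible to second fundamental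
-- forms.
theorem chartHessian_comp {f : S → M} (hf : ContMDiff 𝓘(ℝ, F) 𝓘(ℝ, E) ∞ f) {s : S' → S}
    (hs : ContMDiff 𝓘(ℝ, F') 𝓘(ℝ, F) ∞ s) (p : S') (u v : F') :
    chartHessian E F' (f ∘ s) p u v =
      chartHessian E F f (s p) (modelDiff F F' s p u) (modelDiff F F' s p v) +
        modelDiff E F f (s p) (chartHessian F F' s p u v) := by
  set y₀ := extChartAt 𝓘(ℝ, F') p p with hy₀
  have e0 : inCharts F F' s p y₀ = extChartAt 𝓘(ℝ, F) (s p) (s p) := by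
    simp only [inCharts, Function.comp_apply, hy₀, extChartAt_to_inv]
  have h1 : inCharts E F' (f ∘ s) p =ᶠ[𝓝 y₀] inCharts E F f (s p) ∘ inCharts F F' s p := by
    have : Filter.Tendsto (s ∘ (extChartAt 𝓘(ℝ, F') p).symm) (𝓝 y₀) (𝓝 (s p)) := by
      have h := (continuousAt_extChartAt_symm (I := 𝓘(ℝ, F')) p)
      unfold ContinuousAt at h
      rw [extChartAt_to_inv] at h
      exact hs.continuous.continuousAt.tendsto.comp h
    filter_upwards [this (extChartAt_source_mem_nhds (I := 𝓘(ℝ, F)) (s p))] with y hy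
    simp only [inCharts, Function.comp_apply]
    rw [PartialEquiv.left_inv _ hy]
  have hs2 := hs.contDiffAt_inCharts p
  have hf2 := hf.contDiffAt_inCharts (s p)
  have ds := hs2.differentiableAt (by simp)
  have h2 : fderiv ℝ (inCharts E F' (f ∘ s) p) =ᶠ[𝓝 y₀]
      fun y ↦ (fderiv ℝ (inCharts E F f (s p)) (inCharts F F' s p y)).comp (fderiv ℝ (inCharts F F' s p) y) := by
    refine h1.fderiv.trans ?_
    have a1 := (hs2.of_le (m := 1) (by exact_mod_cast le_top)).eventually (by simp)
    have a2 := (hf2.of_le (m := 1) (by exact_mod_cast le_top)).eventually (by simp)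
    rw [← e0] at a2
    filter_upwards [a1, ds.continuousAt.eventually a2] with y b1 b2
    exact fderiv_comp y (b2.differentiableAt (by simp)) (b1.differentiableAt (by simp))
  have h3 := hf.hasFDerivAt_fderiv_inCharts (s p)
  rw [← e0] at h3
  have h4 := (h3.comp y₀ ds.hasFDerivAt).clm_comp (hs.hasFDerivAt_fderiv_inCharts p)
  have h5 := (h4.congr_of_eventuallyEq h2).fderiv
  have h6 := congrArg (fun L : F' →L[ℝ] F' →L[ℝ] E ↦ L u v) h5
  refine h6.trans ?_
  have h7 : fderiv ℝ (inCharts F F' s p) y₀ = _ := hs.fderiv_inCharts p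
  have h8 : (fderiv ℝ (inCharts E F f (s p)) ∘ inCharts F F' s p) y₀ = modelDiff E F f (s p) := by
    rw [Function.comp_apply, e0, hf.fderiv_inCharts]
  rw [h7, h8]
  simp [add_comm]

end Maps

/-! ### Differentiating fields with values in a moving subspace -/

section Calculus

variable {E : Type*} [NormedAddCommGroup E] [NormedSpace ℝ E] [FiniteDimensional ℝ E]
  {F : Type*} [NormedAddCommGroup F] [NormedSpace ℝ F] [FiniteDimensional ℝ F]

/-- With `P` a left inverse of `L z`, the map `P ∘ L y` stays invertible near `z`. Hence `X = L k`
for the differentiable function `k = (P ∘ L)⁻¹ (P X)`, and the product rule gives the claim with `t`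
the derivative of `k` along `u`. -/
theorem HasFDerivAt.exists_eq_add_of_mem_range {L : F → F →L[ℝ] E} {L' : F →L[ℝ] F →L[ℝ] E}
    {X : F → E} {X' : F →L[ℝ] E} {z : F} (hL : HasFDerivAt L L' z) (hX : HasFDerivAt X X' z)
    (hmem : ∀ᶠ y in 𝓝 z, X y ∈ Set.range (L y)) (hinj : Function.Injective (L z))
    {v : F} (hv : L z v = X z) (u : F) : ∃ t, X' u = L' u v + L z t := by
  have : CompleteSpace F := FiniteDimensional.complete ℝ F
  obtain ⟨P₀, hP₀⟩ := (L z : F →ₗ[ℝ] E).exists_leftInverse_of_injective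
    (LinearMap.ker_eq_bot.2 hinj)
  set P : E →L[ℝ] F := LinearMap.toContinuousLinearMap P₀ with hP
  have hPL : P.comp (L z) = ContinuousLinearMap.id ℝ F := by
    ext w
    exact congrArg (fun T : F →ₗ[ℝ] F ↦ T w) hP₀
  have hA : HasFDerivAt (fun y ↦ P.comp (L y)) _ z := (hasFDerivAt_const P z).clm_comp hL
  have hinv : DifferentiableAt ℝ (fun y ↦ (P.comp (L y)).inverse) z := by
    have h1 := (contDiffAt_map_inverse (𝕜 := ℝ) (n := 1)
      (ContinuousLinearEquiv.refl ℝ F)).differentiableAt (by simp)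
    have h2 : ((ContinuousLinearEquiv.refl ℝ F : F ≃L[ℝ] F) : F →L[ℝ] F) = P.comp (L z) := by
      rw [hPL]; rfl
    rw [h2] at h1
    exact h1.comp z hA.differentiableAt
  have hev : ∀ᶠ y in 𝓝 z, (P.comp (L y)).IsInvertible := by
    have h2 : Set.range ((↑) : (F ≃L[ℝ] F) → F →L[ℝ] F) ∈ 𝓝 (P.comp (L z)) := by
      rw [hPL]; exact ContinuousLinearEquiv.nhds (ContinuousLinearEquiv.refl ℝ F)
    filter_upwards [hA.continuousAt.preimage_mem_nhds h2] with y hy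
    exact hy
  have hk : HasFDerivAt (fun y ↦ (P.comp (L y)).inverse (P (X y))) _ z :=
    hinv.hasFDerivAt.clm_apply ((hasFDerivAt_const P z).clm_apply hX)
  have hkz : (P.comp (L z)).inverse (P (X z)) = v := by
    rw [← hv, hPL, ContinuousLinearMap.inverse_id]
    exact congrArg (fun T : F →L[ℝ] F ↦ T v) hPL
  have hkey : X =ᶠ[𝓝 z] fun y ↦ L y ((P.comp (L y)).inverse (P (X y))) := by
    filter_upwards [hev, hmem] with y h1 ⟨w, hw⟩
    have : (P.comp (L y)).inverse (P (L y w)) = w := h1.inverse_apply_eq.2 rfl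
    rw [← hw, this]
  have hfin := (hL.clm_apply hk).congr_of_eventuallyEq hkey
  have h := congrArg (fun T : F →L[ℝ] E ↦ T u) (hX.unique hfin)
  rw [add_apply, add_comm, ContinuousLinearMap.flip_apply, hkz] at h
  exact ⟨_, h⟩

set_option synthInstance.maxHeartbeats 200000 in
omit [FiniteDimensional ℝ E] [FiniteDimensional ℝ F] in
theorem HasFDerivAt.clm_apply_clm_apply {G : F → E →L[ℝ] E →L[ℝ] ℝ} {G' : F →L[ℝ] E →L[ℝ] E →L[ℝ] ℝ}
    {U V : F → E} {U' V' : F →L[ℝ] E} {z : F} (hG : HasFDerivAt G G' z) (hU : HasFDerivAt U U' z)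
    (hV : HasFDerivAt V V' z) {T : F →L[ℝ] ℝ}
    (hT : HasFDerivAt (fun y ↦ G y (U y) (V y)) T z) (w : F) :
    T w = G' w (U z) (V z) + G z (U' w) (V z) + G z (U z) (V' w) := by
  rw [hT.unique ((hG.clm_apply hU).clm_apply hV)]
  simp
  ring

end Calculus

/-! ### Tangent fields and the Gauss formula -/

section Submanifolds

variable {E : Type*} [NormedAddCommGroup E] [NormedSpace ℝ E]
  {M : Type*} [TopologicalSpace M] [ChartedSpace E M] [IsManifold 𝓘(ℝ, E) ∞ M]
  {F : Type*} [NormedAddCommGroup F] [NormedSpace ℝ F]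
  {S : Type*} [TopologicalSpace S] [ChartedSpace F S] [IsManifold 𝓘(ℝ, F) ∞ S]

omit [IsManifold 𝓘(ℝ, E) ∞ M] [IsManifold 𝓘(ℝ, F) ∞ S] in
theorem inCharts_extChartAt (f : S → M) {q q' : S} (h : q' ∈ (chartAt F q).source) :
    inCharts E F f q (extChartAt 𝓘(ℝ, F) q q') = extChartAt 𝓘(ℝ, E) (f q) (f q') := by
  unfold inCharts
  rw [Function.comp_apply, Function.comp_apply, PartialEquiv.left_inv _ (by simpa using h)]

/-- The derivative of a vector field tangent to a submanifold differs from the second derivative of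
the embedding by a tangent vector. -/
theorem exists_mvfderiv_eq_chartHessian_add [FiniteDimensional ℝ E] [FiniteDimensional ℝ F]
    {f : S → M} (hf : ContMDiff 𝓘(ℝ, F) 𝓘(ℝ, E) ∞ f)
    {q : S} (hinj : Function.Injective (modelDiff E F f q))
    {X : Π x : M, TangentSpace 𝓘(ℝ, E) x} (hX : IsDiffFieldAt X (f q))
    (htan : ∀ q', X (f q') ∈ tangentRange F f q') {v : F} (hv : modelDiff E F f q v = X (f q))
    (u : F) : ∃ t : F,
      (mvfderiv 𝓘(ℝ, E) (fun y ↦ tangentCoord (f q) y (X y)) (f q) (modelDiff E F f q u) : E) =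
        chartHessian E F f q u v + modelDiff E F f q t := by
  have h1 := (isDiffFieldAt_iff.1 hX).hasFDerivAt_comp_extChartAt_symm
  have e0 : inCharts E F f q (extChartAt 𝓘(ℝ, F) q q) = extChartAt 𝓘(ℝ, E) (f q) (f q) :=
    inCharts_extChartAt f (mem_chart_source F q)
  rw [← e0] at h1
  have h2 := ((hf.contDiffAt_inCharts q).differentiableAt (by simp)).hasFDerivAt
  rw [hf.fderiv_inCharts] at h2
  have h3 := h1.comp _ h2
  have h4 : ∀ᶠ y in 𝓝 (extChartAt 𝓘(ℝ, F) q q),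
      ((fun y ↦ tangentCoord (f q) y (X y)) ∘ (extChartAt 𝓘(ℝ, E) (f q)).symm)
        (inCharts E F f q y) ∈ Set.range (fderiv ℝ (inCharts E F f q) y) := by
    refine (eventually_nhds_extChartAt (P := fun y _ ↦ ((fun y ↦ tangentCoord (f q) y (X y)) ∘
      (extChartAt 𝓘(ℝ, E) (f q)).symm) (inCharts E F f q y) ∈
        Set.range (fderiv ℝ (inCharts E F f q) y))).2 ?_
    filter_upwards [chart_source_mem_nhds F q,
      hf.continuous.continuousAt.preimage_mem_nhds (chart_source_mem_nhds E (f q))] with q' h5 h6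
    obtain ⟨w, hw⟩ := htan q'
    refine ⟨tangentCoord q q' w, ?_⟩
    rw [← hf.tangentCoord_mfderiv h5 h6, coordVector_tangentCoord h5, inCharts_extChartAt f h5,
      Function.comp_apply, PartialEquiv.left_inv _ (by simpa using h6)]
    exact congrArg (tangentCoord (f q) (f q')) hw
  have h5 : ((fun y ↦ tangentCoord (f q) y (X y)) ∘ (extChartAt 𝓘(ℝ, E) (f q)).symm)
      (inCharts E F f q (extChartAt 𝓘(ℝ, F) q q)) = X (f q) := by
    rw [e0, Function.comp_apply, PartialEquiv.left_inv _ (mem_extChartAt_source (f q)),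
      tangentCoord_self]
  obtain ⟨t, ht⟩ := (hf.hasFDerivAt_fderiv_inCharts q).exists_eq_add_of_mem_range h3 h4
    (by rwa [hf.fderiv_inCharts]) (v := v) (by rw [hf.fderiv_inCharts]; exact hv.trans h5.symm) u
  rw [hf.fderiv_inCharts] at ht
  exact ⟨t, ht⟩

/-- The isometry condition is needed on a neighbourhood, in coordinates, because it gets
differentiated in `gauss_formula`. -/
theorem inChart_eventuallyEq {h : PseudoRiemMetric F S} {g : PseudoRiemMetric E M} {f : S → M}
    (hf : ContMDiff 𝓘(ℝ, F) 𝓘(ℝ, E) ∞ f)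
    (hiso : ∀ (q : S) (u v : TangentSpace 𝓘(ℝ, F) q),
      h.val q u v = g.val (f q) (diffl f q u) (diffl f q v)) (q : S) (a b : F) :
    (fun z ↦ h.inChart q z a b) =ᶠ[𝓝 (extChartAt 𝓘(ℝ, F) q q)] fun z ↦
      g.inChart (f q) (inCharts E F f q z) (fderiv ℝ (inCharts E F f q) z a)
        (fderiv ℝ (inCharts E F f q) z b) := by
  refine (eventually_nhds_extChartAt (P := fun z _ ↦ h.inChart q z a b =
      g.inChart (f q) (inCharts E F f q z) (fderiv ℝ (inCharts E F f q) z a)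
        (fderiv ℝ (inCharts E F f q) z b))).2 ?_
  filter_upwards [chart_source_mem_nhds F q,
    hf.continuous.continuousAt.preimage_mem_nhds (chart_source_mem_nhds E (f q))] with q' h5 h6
  rw [h.inChart_extChartAt h5, inCharts_extChartAt f h5, g.inChart_extChartAt h6,
    ← hf.tangentCoord_mfderiv h5 h6, ← hf.tangentCoord_mfderiv h5 h6,
    coordVector_tangentCoord h6, coordVector_tangentCoord h6, hiso]

/-- A trilinear form symmetric in the first two and antisymmetric in the last two arguments
vanishes. -/
theorem eq_zero_of_symm_of_antisymm {F : Type*} {A : F → F → F → ℝ} (h1 : ∀ a b c, A a b c = A b a c)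
    (h2 : ∀ a b c, A a b c + A a c b = 0) (a b c : F) : A a b c = 0 := by
  -- Alternating the two swaps returns to the start after six steps, three of them with a sign: `A a
  -- b c = -A a b c`.
  linarith [h1 a b c, h1 b c a, h1 c a b, h2 a b c, h2 b c a, h2 c a b]

set_option synthInstance.maxHeartbeats 200000 in
/-- The tangential part of the covariant derivative along an isometric immersion is the
Levi-Civita connection of the induced metric. -/
theorem gauss_formula [FiniteDimensional ℝ E] [FiniteDimensional ℝ F]
    {h : PseudoRiemMetric F S} {g : PseudoRiemMetric E M} {f : S → M}
    (hf : ContMDiff 𝓘(ℝ, F) 𝓘(ℝ, E) ∞ f)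
    (hiso : ∀ (q : S) (u v : TangentSpace 𝓘(ℝ, F) q),
      h.val q u v = g.val (f q) (diffl f q u) (diffl f q v))
    {D : TangentConnection E M} (hD : IsLeviCivita g D)
    {D' : TangentConnection F S} (hD' : IsLeviCivita h D') (q : S)
    {Γ : E →L[ℝ] E →L[ℝ] E} (hΓs : ∀ a b, Γ a b = Γ b a)
    (hΓ : ∀ X : Π x : M, TangentSpace 𝓘(ℝ, E) x, IsDiffFieldAt X (f q) →
      ∀ w : E, D X (f q) w =
        mvfderiv 𝓘(ℝ, E) (fun y ↦ tangentCoord (f q) y (X y)) (f q) w + Γ (X (f q)) w)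
    {Γ' : F →L[ℝ] F →L[ℝ] F} (hΓs' : ∀ a b, Γ' a b = Γ' b a)
    (hΓ' : ∀ X : Π x : S, TangentSpace 𝓘(ℝ, F) x, IsDiffFieldAt X q →
      ∀ w : F, D' X q w =
        mvfderiv 𝓘(ℝ, F) (fun y ↦ tangentCoord q y (X y)) q w + Γ' (X q) w) (a b c : F) :
    g.form (f q) (chartHessian E F f q a b + Γ (modelDiff E F f q a) (modelDiff E F f q b))
      (modelDiff E F f q c) = h.form q (Γ' a b) c := by
  -- The identity `h(a, b) = g(df a, df b)` is differentiated along `w`, and both metric derivatives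
  -- are expressed by Christoffel symbols.
  have hpol : ∀ w a b : F, h.form q (Γ' a w) b + h.form q a (Γ' b w) =
      g.form (f q) (Γ (modelDiff E F f q a) (modelDiff E F f q w)) (modelDiff E F f q b) +
      g.form (f q) (modelDiff E F f q a) (Γ (modelDiff E F f q b) (modelDiff E F f q w)) +
      g.form (f q) (chartHessian E F f q w a) (modelDiff E F f q b) +
      g.form (f q) (modelDiff E F f q a) (chartHessian E F f q w b) := by
    intro w a b
    rw [← hD'.fderiv_inChart hΓ', ← hD.fderiv_inChart hΓ]
    have e0 : inCharts E F f q (extChartAt 𝓘(ℝ, F) q q) = extChartAt 𝓘(ℝ, E) (f q) (f q) :=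
      inCharts_extChartAt f (mem_chart_source F q)
    have k1 : HasFDerivAt (fun z ↦ h.inChart q z a b)
        (((fderiv ℝ (h.inChart q) (extChartAt 𝓘(ℝ, F) q q)).flip a).flip b)
        (extChartAt 𝓘(ℝ, F) q q) := by
      have := ((h.differentiableAt_inChart q).hasFDerivAt.clm_apply
        (hasFDerivAt_const a _)).clm_apply (hasFDerivAt_const b _)
      simpa only [ContinuousLinearMap.comp_zero, zero_add] using this
    have k2 := (g.differentiableAt_inChart (f q)).hasFDerivAt
    rw [← e0] at k2
    have k3 := ((hf.contDiffAt_inCharts q).differentiableAt (by simp)).hasFDerivAt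
    have k2' := @HasFDerivAt.comp ℝ _ F _ _ E _ _ (E →L[ℝ] E →L[ℝ] ℝ) _ _ _ _ _ _ _ k2 k3
    have k4 := k2'.clm_apply_clm_apply (hf.hasFDerivAt_fderiv_inCharts_apply q a)
      (hf.hasFDerivAt_fderiv_inCharts_apply q b)
      (k1.congr_of_eventuallyEq (inChart_eventuallyEq hf hiso q a b).symm) w
    have e1 : (g.inChart (f q) ∘ inCharts E F f q) (extChartAt 𝓘(ℝ, F) q q) = g.form (f q) := by
      rw [Function.comp_apply, e0, g.inChart_extChartAt_self]
    rw [e0, e1, hf.fderiv_inCharts] at k4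
    exact k4
  -- The defect of the claimed formula is symmetric in `a, b` since both connections are torsion
  -- free, and antisymmetric in `b, c` by `hpol`. This is the uniqueness argument for the
  -- Levi-Civita connection.
  refine sub_eq_zero.1 (eq_zero_of_symm_of_antisymm (A := fun a b c ↦
    g.form (f q) (chartHessian E F f q a b + Γ (modelDiff E F f q a) (modelDiff E F f q b))
      (modelDiff E F f q c) - h.form q (Γ' a b) c) ?_ ?_ a b c)
  · intro a b c
    simp only [hf.chartHessian_symm q a b, hΓs (modelDiff E F f q a), hΓs' a]
  · intro a b c
    have h1 := hpol a b c
    rw [g.form_symm _ _ (Γ _ _), g.form_symm _ _ (chartHessian _ _ _ _ _ _), h.form_symm q b,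
      hΓs' b, hΓs' c, hΓs (modelDiff E F f q b), hΓs (modelDiff E F f q c)] at h1
    simp only [map_add, add_apply]
    linarith

end Submanifolds

/-! ### Normal projections, the second fundamental form and Killing fields -/

section NormalPart

variable {E : Type*} [NormedAddCommGroup E] [NormedSpace ℝ E]
  {M : Type*} [TopologicalSpace M] [ChartedSpace E M] [IsManifold 𝓘(ℝ, E) ∞ M]
  {F : Type*} [NormedAddCommGroup F] [NormedSpace ℝ F]
  {S : Type*} [TopologicalSpace S] [ChartedSpace F S] [IsManifold 𝓘(ℝ, F) ∞ S]

theorem PseudoRiemMetric.mem_orth {g : PseudoRiemMetric E M} {x : M}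
    {W : Submodule ℝ (TangentSpace 𝓘(ℝ, E) x)} {w : TangentSpace 𝓘(ℝ, E) x} :
    w ∈ g.orth W ↔ ∀ v ∈ W, g.val x w v = 0 := by
  refine LinearMap.BilinForm.mem_orthogonal_iff.trans (forall₂_congr fun v _ ↦ ?_)
  rw [g.symm]
  rfl

theorem PseudoRiemMetric.isCompl_orth [FiniteDimensional ℝ E] {g : PseudoRiemMetric E M} {x : M}
    {W : Submodule ℝ (TangentSpace 𝓘(ℝ, E) x)}
    (hW : ∀ w ∈ W, (∀ v ∈ W, g.val x w v = 0) → w = 0) : IsCompl (g.orth W) W := by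
  have : FiniteDimensional ℝ (TangentSpace 𝓘(ℝ, E) x) := inferInstanceAs (FiniteDimensional ℝ E)
  have hr : (g.val x).toBilinForm.IsRefl := fun a b h ↦ by
    have h' : g.val x a b = 0 := h
    rw [g.symm] at h'
    exact h'
  refine ((LinearMap.BilinForm.isCompl_orthogonal_iff_disjoint hr).2 ?_).symm
  rw [Submodule.disjoint_def]
  exact fun w h1 h2 ↦ hW w h1 (g.mem_orth.1 h2)

theorem PseudoRiemMetric.normalPart_mem {g : PseudoRiemMetric E M} {x : M}
    {W : Submodule ℝ (TangentSpace 𝓘(ℝ, E) x)} (h : IsCompl (g.orth W) W)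
    (w : TangentSpace 𝓘(ℝ, E) x) : g.normalPart W w ∈ g.orth W := by
  rw [PseudoRiemMetric.normalPart, dif_pos h]
  exact Submodule.projection_apply_mem h w

theorem PseudoRiemMetric.sub_normalPart_mem {g : PseudoRiemMetric E M} {x : M}
    {W : Submodule ℝ (TangentSpace 𝓘(ℝ, E) x)} (h : IsCompl (g.orth W) W)
    (w : TangentSpace 𝓘(ℝ, E) x) : w - g.normalPart W w ∈ W := by
  rw [PseudoRiemMetric.normalPart, dif_pos h, ← Submodule.projection_apply_eq_zero_iff h, map_sub,
    Submodule.projection_apply_of_mem_left h (Submodule.projection_apply_mem h w), sub_self]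

theorem PseudoRiemMetric.normalPart_eq {g : PseudoRiemMetric E M} {x : M}
    {W : Submodule ℝ (TangentSpace 𝓘(ℝ, E) x)} (h : IsCompl (g.orth W) W)
    {w n : TangentSpace 𝓘(ℝ, E) x} (hn : n ∈ g.orth W) (hwn : w - n ∈ W) :
    g.normalPart W w = n := by
  rw [PseudoRiemMetric.normalPart, dif_pos h, ← sub_add_cancel w n, map_add,
    Submodule.projection_apply_of_mem_left h hn, (Submodule.projection_apply_eq_zero_iff h).2 hwn,
    zero_add]

theorem PseudoRiemMetric.isCompl_orth_tangentRange [FiniteDimensional ℝ E]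
    {h : PseudoRiemMetric F S} {g : PseudoRiemMetric E M} {f : S → M}
    (hf : IsIsometricEmbedding h g f) (q : S) :
    IsCompl (g.orth (tangentRange F f q)) (tangentRange F f q) := by
  refine g.isCompl_orth ?_
  rintro _ ⟨a, rfl⟩ ha
  have : a = 0 := h.nondegenerate q a fun b ↦ by
    rw [hf.isometric]
    exact ha _ ⟨b, rfl⟩
  rw [this]
  exact map_zero (diffl f q)

theorem PseudoRiemMetric.IsRiemannian.isCompl_orth [FiniteDimensional ℝ E]
    {g : PseudoRiemMetric E M} (hg : g.IsRiemannian) {x : M}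
    (W : Submodule ℝ (TangentSpace 𝓘(ℝ, E) x)) : IsCompl (g.orth W) W :=
  g.isCompl_orth fun w hw h ↦ by_contra fun h0 ↦ (hg x w h0).ne' (h w hw)

/-- `Γ` are the Christoffel symbols at `x` of the torsion free connection `D`, in the chart
at `x`. -/
structure IsChristoffelAt (D : TangentConnection E M) (x : M) (Γ : E →L[ℝ] E →L[ℝ] E) : Prop where
  symm (a b : E) : Γ a b = Γ b a
  eq_add (X : Π x : M, TangentSpace 𝓘(ℝ, E) x) (hX : IsDiffFieldAt X x) (w : E) :
    D X x w = mvfderiv 𝓘(ℝ, E) (fun y ↦ tangentCoord x y (X y)) x w + Γ (X x) w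

/-- The second fundamental form, as a map between the model spaces. -/
noncomputable def modelSecondForm (g : PseudoRiemMetric E M) (D : TangentConnection E M) (f : S → M)
    (q : S) (u v : F) : E :=
  secondFundamentalForm g D f q u v

/-- The normal part characterizes the second fundamental form. -/
theorem modelSecondForm_eq_iff [FiniteDimensional ℝ E] {g : PseudoRiemMetric E M}
    {D : TangentConnection E M} {f : S → M} (hf : ContMDiff 𝓘(ℝ, F) 𝓘(ℝ, E) ∞ f) {q : S}
    (hc : IsCompl (g.orth (tangentRange F f q)) (tangentRange F f q)) {x : M} (hx : f q = x)
    {Γ : E →L[ℝ] E →L[ℝ] E} (hΓ : IsChristoffelAt D x Γ) {u v : F} {n : E} :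
    modelSecondForm g D f q u v = n ↔
      (∀ w : F, g.form x n (modelDiff E F f q w) = 0) ∧
        ∃ t : F, chartHessian E F f q u v + Γ (modelDiff E F f q u) (modelDiff E F f q v) =
          n + modelDiff E F f q t := by
  subst hx
  have hcov := covDerivAlong_diffl hf q hΓ.eq_add u v
  rw [hΓ.symm] at hcov
  constructor
  · rintro rfl
    refine ⟨fun w ↦ g.mem_orth.1 (g.normalPart_mem hc _) _ ⟨w, rfl⟩, ?_⟩
    obtain ⟨t, ht⟩ := g.sub_normalPart_mem hc
      (covDerivAlong D f (fun q' ↦ diffl f q' (FiberBundle.extend F v q')) q u)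
    exact ⟨t, hcov.symm.trans (eq_add_of_sub_eq' ht.symm)⟩
  · rintro ⟨h1, t, ht⟩
    refine g.normalPart_eq hc (g.mem_orth.2 ?_) ?_
    · rintro _ ⟨w, rfl⟩
      exact h1 w
    · exact ⟨t, (sub_eq_of_eq_add' (hcov.trans ht)).symm⟩

theorem modelSecondForm_symm [FiniteDimensional ℝ E] {g : PseudoRiemMetric E M}
    {D : TangentConnection E M} {f : S → M} (hf : ContMDiff 𝓘(ℝ, F) 𝓘(ℝ, E) ∞ f) {q : S}
    (hc : IsCompl (g.orth (tangentRange F f q)) (tangentRange F f q))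
    {Γ : E →L[ℝ] E →L[ℝ] E} (hΓ : IsChristoffelAt D (f q) Γ) (u v : F) :
    modelSecondForm g D f q u v = modelSecondForm g D f q v u := by
  have h := (modelSecondForm_eq_iff hf hc rfl hΓ (u := v) (v := u)).1 rfl
  rw [hf.chartHessian_symm, hΓ.symm] at h
  exact (modelSecondForm_eq_iff hf hc rfl hΓ).2 h

/-- Two Killing fields tangent to a submanifold determine the value of the second fundamental form
on them. -/
theorem mvfderiv_val_eq_modelSecondForm [FiniteDimensional ℝ E] [FiniteDimensional ℝ F]
    {g : PseudoRiemMetric E M} {D : TangentConnection E M} (hD : IsLeviCivita g D) {f : S → M}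
    (hf : ContMDiff 𝓘(ℝ, F) 𝓘(ℝ, E) ∞ f) {q : S}
    (hc : IsCompl (g.orth (tangentRange F f q)) (tangentRange F f q))
    (hinj : Function.Injective (modelDiff E F f q)) {x : M} (hx : f q = x)
    {X Y : Π x : M, TangentSpace 𝓘(ℝ, E) x} (hX : IsKilling g D X) (hY : IsKilling g D Y)
    (hXt : ∀ q, X (f q) ∈ tangentRange F f q) (hYt : ∀ q, Y (f q) ∈ tangentRange F f q)
    {a b : F} (ha : modelDiff E F f q a = X x) (hb : modelDiff E F f q b = Y x)
    {n : E} (hn : ∀ w : F, g.form x n (modelDiff E F f q w) = 0) :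
    mvfderiv 𝓘(ℝ, E) (fun y ↦ g.val y (X y) (Y y)) x n =
      -(2 * g.form x (modelSecondForm g D f q a b) n) := by
  subst hx
  obtain ⟨Γ, hΓs, hΓ⟩ := hD.exists_christoffel (f q)
  have hΓ' : IsChristoffelAt D (f q) Γ := ⟨hΓs, hΓ⟩
  -- For a field tangent to the submanifold, the ambient covariant derivative and II differ by a
  -- tangent vector, which pairs to zero with `n`.
  have key : ∀ {X : Π x : M, TangentSpace 𝓘(ℝ, E) x} (_ : IsKilling g D X)
      (_ : ∀ q, X (f q) ∈ tangentRange F f q) {a : F} (_ : modelDiff E F f q a = X (f q)) (b : F),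
      g.form (f q) n (D X (f q) (modelDiff E F f q b)) =
        g.form (f q) n (modelSecondForm g D f q b a) := by
    intro X hX hXt a ha b
    obtain ⟨t, ht⟩ := exists_mvfderiv_eq_chartHessian_add hf hinj
      (IsSmoothField.isDiffFieldAt hX.smooth (f q)) hXt ha b
    obtain ⟨-, t', ht'⟩ := (modelSecondForm_eq_iff hf hc rfl hΓ' (u := b) (v := a)).1 rfl
    have h1 : (D X (f q) (modelDiff E F f q b) : E) =
        modelSecondForm g D f q b a + modelDiff E F f q (t + t') := by
      refine (hΓ X (IsSmoothField.isDiffFieldAt hX.smooth (f q)) _).trans ?_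
      have h2 : Γ (X (f q)) (modelDiff E F f q b) =
          Γ (modelDiff E F f q b) (modelDiff E F f q a) :=
        (hΓs _ _).trans (congrArg (Γ (modelDiff E F f q b)) ha.symm)
      refine (congrArg₂ (fun a b : E ↦ a + b) ht h2).trans ?_
      rw [add_right_comm, ht', map_add]
      abel
    refine (congrArg (g.form (f q) n) h1).trans ?_
    rw [map_add, hn, add_zero]
  have h0 := hD.metric X Y (f q) (IsSmoothField.isDiffFieldAt hX.smooth (f q))
    (IsSmoothField.isDiffFieldAt hY.smooth (f q)) n
  -- The Killing equation replaces the derivative in the direction `n` by one in a tangential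
  -- direction, to which `key` applies.
  have h1 := hX.killing (f q) n (Y (f q))
  have h2 := hY.killing (f q) n (X (f q))
  have h3 : g.val (f q) n (D X (f q) (Y (f q))) = _ := (congrArg (fun w : E ↦
    g.form (f q) n (D X (f q) w)) hb.symm).trans (key hX hXt ha b)
  have h4 : g.val (f q) n (D Y (f q) (X (f q))) = _ := (congrArg (fun w : E ↦
    g.form (f q) n (D Y (f q) w)) ha.symm).trans (key hY hYt hb a)
  rw [modelSecondForm_symm hf hc hΓ' b a] at h3
  have h6 := g.symm (f q) (D Y (f q) n) (X (f q))
  refine h0.trans ?_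
  rw [g.form_symm]
  linarith

end NormalPart

/-! ### Embeddings, normal derivatives and sections of submanifolds -/

section Embeddings

variable {E : Type*} [NormedAddCommGroup E] [NormedSpace ℝ E]
  {M : Type*} [TopologicalSpace M] [ChartedSpace E M] [IsManifold 𝓘(ℝ, E) ∞ M]
  {F : Type*} [NormedAddCommGroup F] [NormedSpace ℝ F]
  {S : Type*} [TopologicalSpace S] [ChartedSpace F S] [IsManifold 𝓘(ℝ, F) ∞ S]

theorem IsIsometricEmbedding.injective_modelDiff {h : PseudoRiemMetric F S}
    {g : PseudoRiemMetric E M} {f : S → M} (hf : IsIsometricEmbedding h g f) (q : S) :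
    Function.Injective (modelDiff E F f q) := by
  refine (injective_iff_map_eq_zero _).2 fun a ha ↦ h.nondegenerate q a fun b ↦ ?_
  refine (hf.isometric q a b).trans ?_
  have h0 : g.form (f q) (modelDiff E F f q a) (modelDiff E F f q b) = 0 := by
    rw [ha, map_zero, zero_apply]
  exact h0

theorem IsIsometricEmbedding.form_modelDiff {h : PseudoRiemMetric F S}
    {g : PseudoRiemMetric E M} {f : S → M} (hf : IsIsometricEmbedding h g f) {q : S} {x : M}
    (hx : f q = x) (a b : F) :
    g.form x (modelDiff E F f q a) (modelDiff E F f q b) = h.form q a b := by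
  subst hx
  exact (hf.isometric q a b).symm

omit [IsManifold 𝓘(ℝ, E) ∞ M] in
theorem OpenPartialHomeomorph.mdifferentiable_of_mem_maximalAtlas
    {e : OpenPartialHomeomorph M E} (he : e ∈ IsManifold.maximalAtlas 𝓘(ℝ, E) ∞ M) :
    e.MDifferentiable 𝓘(ℝ, E) 𝓘(ℝ, E) :=
  ⟨(contMDiffOn_of_mem_maximalAtlas he).mdifferentiableOn (by simp),
    (contMDiffOn_symm_of_mem_maximalAtlas he).mdifferentiableOn (by simp)⟩

omit [IsManifold 𝓘(ℝ, E) ∞ M] [IsManifold 𝓘(ℝ, F) ∞ S] in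
-- In the normal form of an immersion, the domain chart factors through `f` by projecting the
-- codomain chart to its first component. Since the differential of the domain chart is injective,
-- so is that of `f`. This version needs no metric on the source, as for the embedding of S' into
-- the slice.
theorem Manifold.IsSmoothEmbedding.injective_modelDiff {f : S → M}
    (hf : IsSmoothEmbedding 𝓘(ℝ, F) 𝓘(ℝ, E) ∞ f) (q : S) :
    Function.Injective (modelDiff E F f q) := by
  have hc := hf.isImmersion.isImmersionOfComplement_complement q
  set e := hc.domChart
  set e' := hc.codChart
  set L : E →L[ℝ] F := (ContinuousLinearMap.fst ℝ F _).comp hc.equiv.symm.toContinuousLinearMap with hL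
  have hev : e =ᶠ[𝓝 q] (L ∘ e') ∘ f := by
    filter_upwards [e.open_source.mem_nhds hc.mem_domChart_source] with y hy
    have h0 : e y ∈ (e.extend 𝓘(ℝ, F)).target := by simpa using e.map_source hy
    have h1 := hc.writtenInCharts h0
    have h2 : e' (f y) = hc.equiv (e y, 0) := by
      have h2 : hc.codChart (f (e.symm (e y))) = hc.equiv (e y, 0) := by simpa using h1
      rwa [e.left_inv hy] at h2
    simp [hL, h2]
  have hd' : MDifferentiableAt 𝓘(ℝ, E) 𝓘(ℝ, F) (L ∘ e') (f q) :=
    (L.differentiableAt.mdifferentiableAt).comp (f q)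
      ((OpenPartialHomeomorph.mdifferentiable_of_mem_maximalAtlas
        hc.codChart_mem_maximalAtlas).mdifferentiableAt hc.mem_codChart_source)
  have h3 : mfderiv 𝓘(ℝ, F) 𝓘(ℝ, F) e q = _ := hev.mfderiv_eq.trans
    (mfderiv_comp q hd' (hf.contMDiff.mdifferentiable (by simp) q))
  have h4 := (OpenPartialHomeomorph.mdifferentiable_of_mem_maximalAtlas
    hc.domChart_mem_maximalAtlas).mfderiv_injective hc.mem_domChart_source
  intro a b hab
  apply h4
  have h5 : ∀ a : F, (mfderiv 𝓘(ℝ, F) 𝓘(ℝ, F) e q a : F) =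
      mfderiv 𝓘(ℝ, E) 𝓘(ℝ, F) (L ∘ e') (f q) (modelDiff E F f q a) := fun a ↦
    congrArg (fun T : F →L[ℝ] F ↦ T a) h3
  exact (h5 a).trans ((congrArg _ hab).trans (h5 b).symm)

omit [IsManifold 𝓘(ℝ, F) ∞ S] in
-- `tangentAt` collects the tangent vectors from every preimage of `x`; injectivity leaves only the
-- preimage `q`.
theorem PseudoRiemMetric.mem_orth_tangentAt {g : PseudoRiemMetric E M} {f : S → M}
    (hf : Function.Injective f) {q : S} {x : M} (hx : f q = x) {n : TangentSpace 𝓘(ℝ, E) x} :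
    n ∈ g.orth (tangentAt F f x) ↔ ∀ w : F, g.form x n (modelDiff E F f q w) = 0 := by
  subst hx
  rw [g.mem_orth]
  constructor
  · exact fun h w ↦ h _ (Submodule.subset_span ⟨⟨q, w⟩, rfl⟩)
  · intro h v hv
    induction hv using Submodule.span_induction with
    | mem v hv =>
      obtain ⟨⟨q', w⟩, hw⟩ := hv
      obtain rfl : q' = q := hf (congrArg TotalSpace.proj hw)
      have : diffl f q' w = v := by simpa [tangentMap] using hw
      rw [← this]
      exact h w
    | zero => exact map_zero _
    | add v w _ _ h1 h2 => rw [map_add, h1, h2, add_zero]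
    | smul a v _ h1 => rw [map_smul, h1, smul_zero]

omit [IsManifold 𝓘(ℝ, F) ∞ S] in
-- The frame formula is the metric dual of the differential of `φ` restricted to the normal space.
-- Expanding `c` in the frame, each coefficient reappears multiplied by `ε_A ^ 2 = 1`.
theorem IsNormalFrame.normalDeriv_eq {g : PseudoRiemMetric E M} {f : S → M} {x : M} {k : ℕ}
    {ξ : Fin k → TangentSpace 𝓘(ℝ, E) x} (hξ : IsNormalFrame F g f x ξ) {φ : M → ℝ}
    {c : TangentSpace 𝓘(ℝ, E) x} (hc : c ∈ g.orth (tangentAt F f x))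
    (h : ∀ n ∈ g.orth (tangentAt F f x), mvfderiv 𝓘(ℝ, E) φ x n = g.val x c n) :
    normalDeriv g x ξ φ = c := by
  rw [← hξ.span_eq, Submodule.mem_span_range_iff_exists_fun] at hc
  obtain ⟨a, rfl⟩ := hc
  refine Finset.sum_congr rfl fun A _ ↦ ?_
  have hA : ξ A ∈ g.orth (tangentAt F f x) := hξ.span_eq ▸ Submodule.subset_span ⟨A, rfl⟩
  rw [h _ hA, map_sum, sum_apply, Finset.sum_eq_single A]
  · rw [map_smul, smul_apply, smul_eq_mul, mul_left_comm, ← abs_mul_abs_self, hξ.unit]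
    simp
  · intro B _ hB
    rw [map_smul, smul_apply, hξ.orthogonal B A hB, smul_zero]
  · simp

variable {F₁ : Type*} [NormedAddCommGroup F₁] [NormedSpace ℝ F₁]
  {N : Type*} [TopologicalSpace N] [ChartedSpace F₁ N] [IsManifold 𝓘(ℝ, F₁) ∞ N]
  {F₂ : Type*} [NormedAddCommGroup F₂] [NormedSpace ℝ F₂]
  {S' : Type*} [TopologicalSpace S'] [ChartedSpace F₂ S'] [IsManifold 𝓘(ℝ, F₂) ∞ S']

omit [IsManifold 𝓘(ℝ, E) ∞ M] [IsManifold 𝓘(ℝ, F) ∞ S] [IsManifold 𝓘(ℝ, F₁) ∞ N] in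
/-- A smooth map with values in an embedded submanifold is smooth into the submanifold. -/
theorem Manifold.IsSmoothEmbedding.exists_lift {f : S → M}
    (hf : IsSmoothEmbedding 𝓘(ℝ, F) 𝓘(ℝ, E) ∞ f) {φ : N → M}
    (hφ : ContMDiff 𝓘(ℝ, F₁) 𝓘(ℝ, E) ∞ φ) (h : ∀ y, φ y ∈ Set.range f) :
    ∃ s : N → S, ContMDiff 𝓘(ℝ, F₁) 𝓘(ℝ, F) ∞ s ∧ f ∘ s = φ := by
  choose s hs using h
  have hs' : f ∘ s = φ := funext hs
  refine ⟨s, (ContMDiff.iff_comp_isImmersion hf.isImmersion).2 ⟨?_, ?_⟩, hs'⟩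
  · rw [hf.isEmbedding.continuous_iff, hs']
    exact hφ.continuous
  · rwa [hs']

/-- The second fundamental form of the intersection `S'` of two submanifolds `S` and `N` in `N`,
if the vectors normal to `N` are tangent to `S`. -/
theorem modelDiff_modelSecondForm [FiniteDimensional ℝ E] [FiniteDimensional ℝ F₁]
    {g : PseudoRiemMetric E M} {D : TangentConnection E M} (hD : IsLeviCivita g D)
    {f : S → M} (hf : ContMDiff 𝓘(ℝ, F) 𝓘(ℝ, E) ∞ f)
    {h : PseudoRiemMetric F₁ N} {D' : TangentConnection F₁ N} (hD' : IsLeviCivita h D')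
    {κ : N → M} (hκ : IsIsometricEmbedding h g κ)
    {i : S' → N} (hi : ContMDiff 𝓘(ℝ, F₂) 𝓘(ℝ, F₁) ∞ i)
    {s : S' → S} (hs : ContMDiff 𝓘(ℝ, F₂) 𝓘(ℝ, F) ∞ s) (hsi : f ∘ s = κ ∘ i) {p : S'}
    (hc : IsCompl (g.orth (tangentRange F f (s p))) (tangentRange F f (s p)))
    (hc' : IsCompl (h.orth (tangentRange F₂ i p)) (tangentRange F₂ i p))
    (hN : ∀ n : E, (∀ w, g.form (κ (i p)) n (modelDiff E F f (s p) w) = 0) →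
      n ∈ Set.range (modelDiff E F₁ κ (i p)))
    (hO : ∀ n : E, (∀ w, g.form (κ (i p)) n (modelDiff E F₁ κ (i p) w) = 0) →
      n ∈ Set.range (modelDiff E F f (s p)))
    (hT : ∀ a b, modelDiff E F₁ κ (i p) a = modelDiff E F f (s p) b →
      a ∈ Set.range (modelDiff F₁ F₂ i p)) (u v : F₂) :
    modelDiff E F₁ κ (i p) (modelSecondForm h D' i p u v) =
      modelSecondForm g D f (s p) (modelDiff F F₂ s p u) (modelDiff F F₂ s p v) := by
  have hx : f (s p) = κ (i p) := congrFun hsi p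
  have hκs := hκ.embedding.contMDiff
  obtain ⟨Γ, hΓs, hΓ⟩ := hD.exists_christoffel (κ (i p))
  obtain ⟨Γ', hΓs', hΓ'⟩ := hD'.exists_christoffel (i p)
  have hcomp : ∀ u : F₂, modelDiff E F f (s p) (modelDiff F F₂ s p u) =
      modelDiff E F₁ κ (i p) (modelDiff F₁ F₂ i p u) := fun u ↦ by
    have h1 := modelDiff_comp hf hs p
    rw [hsi, modelDiff_comp hκs hi p] at h1
    exact (congrArg (fun T : F₂ →L[ℝ] E ↦ T u) h1).symm
  obtain ⟨h1, t, ht⟩ := (modelSecondForm_eq_iff hf hc hx ⟨hΓs, hΓ⟩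
    (u := modelDiff F F₂ s p u) (v := modelDiff F F₂ s p v)).1 rfl
  obtain ⟨c, hc0⟩ := hN _ h1
  rw [← hc0]
  congr 1
  -- By the Gauss formula, the ambient covariant derivative minus the intrinsic one is normal to
  -- `N`, hence tangent to `S`.
  obtain ⟨t₁, ht₁⟩ := hO (chartHessian E F₁ κ (i p) (modelDiff F₁ F₂ i p u) (modelDiff F₁ F₂ i p v)
    + Γ (modelDiff E F₁ κ (i p) (modelDiff F₁ F₂ i p u))
      (modelDiff E F₁ κ (i p) (modelDiff F₁ F₂ i p v)) -
      modelDiff E F₁ κ (i p) (Γ' (modelDiff F₁ F₂ i p u) (modelDiff F₁ F₂ i p v))) (by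
    intro w
    rw [map_sub, sub_apply, gauss_formula hκs hκ.isometric hD hD' (i p) hΓs hΓ hΓs' hΓ',
      hκ.form_modelDiff rfl, sub_self])
  refine (modelSecondForm_eq_iff hi hc' rfl ⟨hΓs', hΓ'⟩).2 ⟨fun w ↦ ?_, ?_⟩
  · rw [← hκ.form_modelDiff rfl, hc0, ← hcomp, h1]
  · have hH := chartHessian_comp hf hs p u v
    rw [hsi, chartHessian_comp hκs hi p] at hH
    -- The remainder is tangent to `N` by construction. Comparing the two chain rules for `f ∘ s = κ
    -- ∘ i` shows that it is also tangent to `S`, hence to the intersection.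
    obtain ⟨t₂, ht₂⟩ := hT (chartHessian F₁ F₂ i p u v +
      Γ' (modelDiff F₁ F₂ i p u) (modelDiff F₁ F₂ i p v) - c)
      (chartHessian F F₂ s p u v + t - t₁) (by
        rw [hcomp, hcomp] at ht
        simp only [map_sub, map_add, ht₁, hc0]
        linear_combination (norm := module) ht + hH)
    exact ⟨t₂, (sub_eq_iff_eq_add'.1 ht₂.symm)⟩

end Embeddings

/-- The tangent space of a hypersurface section of `S` is the intersection of the tangent
spaces. -/
theorem mem_range_of_finrank_add_one {E F F₁ F₂ : Type*} [AddCommGroup E] [Module ℝ E]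
    [AddCommGroup F] [Module ℝ F] [FiniteDimensional ℝ F] [AddCommGroup F₁] [Module ℝ F₁]
    [AddCommGroup F₂] [Module ℝ F₂]
    (hdim : Module.finrank ℝ F₂ + 1 = Module.finrank ℝ F) {A : F →ₗ[ℝ] E} {C : F₁ →ₗ[ℝ] E}
    {I : F₂ →ₗ[ℝ] F₁} {T : F₂ →ₗ[ℝ] F} (hcomp : ∀ u, A (T u) = C (I u))
    (hC : Function.Injective C) (hI : Function.Injective I) {o : F}
    (ho : A o ∉ C.range) {a : F₁} {b : F} (hab : C a = A b) : a ∈ Set.range I := by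
  have hT : Function.Injective T := fun u v huv ↦ hI (hC (by rw [← hcomp, ← hcomp, huv]))
  have hle : T.range ≤ C.range.comap A := by
    rintro _ ⟨u, rfl⟩
    exact ⟨I u, (hcomp u).symm⟩
  -- The vector `o` makes the intersection a proper subspace, so its dimension is at most that of
  -- `F₂`.
  have hlt : Module.finrank ℝ (C.range.comap A) < Module.finrank ℝ F :=
    Submodule.finrank_lt fun h ↦ ho (h.ge trivial : o ∈ C.range.comap A)
  have heq : T.range = C.range.comap A := by
    refine Submodule.eq_of_le_of_finrank_le hle ?_
    rw [LinearMap.finrank_range_of_inj hT]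
    omega
  obtain ⟨t, rfl⟩ : b ∈ T.range := heq ▸ ⟨a, hab⟩
  exact ⟨t, hC (by rw [hab, hcomp])⟩

/-! ### Logarithmic derivatives of the Killing norms -/

section ScalarFunctions

variable {E : Type*} [NormedAddCommGroup E] [NormedSpace ℝ E]
  {M : Type*} [TopologicalSpace M] [ChartedSpace E M] [IsManifold 𝓘(ℝ, E) ∞ M]

theorem mvfderiv_of_hasFDerivAt_comp_extChartAt_symm {f : M → ℝ} {x : M} {L : E →L[ℝ] ℝ}
    (h : HasFDerivAt (fun z ↦ f ((extChartAt 𝓘(ℝ, E) x).symm z)) L (extChartAt 𝓘(ℝ, E) x x)) :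
    mvfderiv 𝓘(ℝ, E) f x = L := by
  have : IsManifold 𝓘(ℝ, E) 1 M := IsManifold.of_le (n := ∞) (by simp)
  refine mvfderiv_of_eventuallyEq_comp_extChartAt ?_ h
  filter_upwards [extChartAt_source_mem_nhds (I := 𝓘(ℝ, E)) x] with y hy
  rw [Function.comp_apply, PartialEquiv.left_inv _ hy]

theorem PseudoRiemMetric.mdifferentiableAt_val (g : PseudoRiemMetric E M) {x : M}
    {X Y : Π x : M, TangentSpace 𝓘(ℝ, E) x} (hX : IsDiffFieldAt X x) (hY : IsDiffFieldAt Y x) :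
    MDifferentiableAt 𝓘(ℝ, E) 𝓘(ℝ, ℝ) (fun y ↦ g.val y (X y) (Y y)) x := by
  have : IsManifold 𝓘(ℝ, E) 1 M := IsManifold.of_le (n := ∞) (by simp)
  have h := ((g.differentiableAt_inChart x).hasFDerivAt.clm_apply
    (isDiffFieldAt_iff.1 hX).hasFDerivAt_comp_extChartAt_symm).clm_apply
    (isDiffFieldAt_iff.1 hY).hasFDerivAt_comp_extChartAt_symm
  refine (hasMFDerivAt_of_eventuallyEq_comp_extChartAt ?_ h).mdifferentiableAt
  filter_upwards [chart_source_mem_nhds E x] with y hy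
  simp only [Function.comp_apply]
  rw [PartialEquiv.left_inv _ (by simpa using hy), g.inChart_extChartAt hy,
    coordVector_tangentCoord hy, coordVector_tangentCoord hy]

theorem mvfderiv_log {f : M → ℝ} {x : M} (hf : MDifferentiableAt 𝓘(ℝ, E) 𝓘(ℝ, ℝ) f x)
    (h0 : f x ≠ 0) (n : E) :
    mvfderiv 𝓘(ℝ, E) (fun y ↦ Real.log (f y)) x n = (f x)⁻¹ * mvfderiv 𝓘(ℝ, E) f x n := by
  have h := hf.hasFDerivAt_comp_extChartAt_symm.log
    (by rwa [Function.comp_apply, extChartAt_to_inv])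
  have h2 := congrArg (fun L : E →L[ℝ] ℝ ↦ L n)
    (mvfderiv_of_hasFDerivAt_comp_extChartAt_symm (f := fun y ↦ Real.log (f y)) h)
  refine h2.trans ?_
  simp only [Function.comp_apply, extChartAt_to_inv]
  rfl


/-- Here `a, b, c` stand for the Gram entries `tt, tφ, φφ` and `o` for `ω`. No term in `o'`
survives, because its coefficient is a multiple of `b₀ + o₀ * c₀ = ⟨ω̂, Kφ⟩ = 0`; the variability of
`ω` thus does not matter at the point. -/
theorem hasFDerivAt_log_sqrt_div_sqrt {a b c o : E → ℝ} {a' b' c' o' : E →L[ℝ] ℝ} {z : E}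
    (ha : HasFDerivAt a a' z) (hb : HasFDerivAt b b' z) (hc : HasFDerivAt c c' z)
    (ho : HasFDerivAt o o' z) {ρ a₀ b₀ c₀ o₀ : ℝ} (ha₀ : a z = a₀) (hb₀ : b z = b₀) (hc₀ : c z = c₀)
    (ho₀ : o z = o₀) (hA : ρ ^ 2 * a₀ + 2 * ρ * b₀ + c₀ ≠ 0)
    (hB : a₀ + 2 * o₀ * b₀ + o₀ ^ 2 * c₀ ≠ 0) (h0 : b₀ + o₀ * c₀ = 0) :
    ∃ L : E →L[ℝ] ℝ, HasFDerivAt (fun y ↦ Real.log (√|ρ ^ 2 * a y + 2 * ρ * b y + c y| /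
        √|a y + 2 * o y * b y + o y ^ 2 * c y|)) L z ∧
      ∀ n, L n = (ρ ^ 2 * a' n + 2 * ρ * b' n + c' n) / (2 * (ρ ^ 2 * a₀ + 2 * ρ * b₀ + c₀)) -
        (a' n + 2 * o₀ * b' n + o₀ ^ 2 * c' n) / (2 * (a₀ + 2 * o₀ * b₀ + o₀ ^ 2 * c₀)) := by
  subst ha₀ hb₀ hc₀ ho₀
  have h1 := ((ha.const_mul (ρ ^ 2)).fun_add (hb.const_mul (2 * ρ))).fun_add hc
  have h2 := (ha.fun_add ((ho.const_mul 2).fun_mul hb)).fun_add ((ho.pow 2).fun_mul hc)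
  refine ⟨_, (((h1.log hA).const_mul 2⁻¹).fun_sub ((h2.log hB).const_mul 2⁻¹)).congr_of_eventuallyEq
    ?_, fun n ↦ ?_⟩
  · filter_upwards [h1.continuousAt.eventually_ne hA, h2.continuousAt.eventually_ne hB]
      with y hy1 hy2
    rw [Real.log_div (Real.sqrt_ne_zero'.2 (abs_pos.2 hy1)) (Real.sqrt_ne_zero'.2 (abs_pos.2 hy2)),
      Real.log_sqrt (abs_nonneg _), Real.log_sqrt (abs_nonneg _), Real.log_abs, Real.log_abs]
    ring
  · simp only [add_apply, smul_apply, sub_apply, smul_eq_mul, nsmul_eq_mul]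
    have e : b z = -(o z * c z) := by linarith
    rw [e] at hA hB ⊢
    field_simp
    push_cast
    ring

omit [IsManifold 𝓘(ℝ, E) ∞ M] in
theorem comp_extChartAt_symm_extChartAt (f : M → ℝ) (x : M) :
    (f ∘ (extChartAt 𝓘(ℝ, E) x).symm) (extChartAt 𝓘(ℝ, E) x x) = f x :=
  congrArg f (extChartAt_to_inv x)

theorem mvfderiv_log_norm_div_norm (g : PseudoRiemMetric E M) {Kt Kφ : Π x : M, TangentSpace 𝓘(ℝ, E) x}
    {x : M} (ht : IsDiffFieldAt Kt x) (hφ : IsDiffFieldAt Kφ x) (ρ : ℝ) {om : M → ℝ}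
    (hom : MDifferentiableAt 𝓘(ℝ, E) 𝓘(ℝ, ℝ) om x)
    (hρ : g.val x (rhoHat Kt Kφ ρ x) (rhoHat Kt Kφ ρ x) ≠ 0)
    (hω : g.val x (omegaHat Kt Kφ om x) (omegaHat Kt Kφ om x) ≠ 0)
    (hωφ : g.val x (Kt x) (Kφ x) + om x * g.val x (Kφ x) (Kφ x) = 0) (n : E) :
    mvfderiv 𝓘(ℝ, E) (fun y ↦
        Real.log (g.norm (rhoHat Kt Kφ ρ) y / g.norm (omegaHat Kt Kφ om) y)) x n =
      (ρ ^ 2 * mvfderiv 𝓘(ℝ, E) (fun y ↦ g.val y (Kt y) (Kt y)) x n +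
        2 * ρ * mvfderiv 𝓘(ℝ, E) (fun y ↦ g.val y (Kt y) (Kφ y)) x n +
        mvfderiv 𝓘(ℝ, E) (fun y ↦ g.val y (Kφ y) (Kφ y)) x n) /
        (2 * g.val x (rhoHat Kt Kφ ρ x) (rhoHat Kt Kφ ρ x)) -
      (mvfderiv 𝓘(ℝ, E) (fun y ↦ g.val y (Kt y) (Kt y)) x n +
        2 * om x * mvfderiv 𝓘(ℝ, E) (fun y ↦ g.val y (Kt y) (Kφ y)) x n +
        om x ^ 2 * mvfderiv 𝓘(ℝ, E) (fun y ↦ g.val y (Kφ y) (Kφ y)) x n) /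
        (2 * g.val x (omegaHat Kt Kφ om x) (omegaHat Kt Kφ om x)) := by
  have eρ : ∀ y, g.val y (rhoHat Kt Kφ ρ y) (rhoHat Kt Kφ ρ y) = ρ ^ 2 * g.val y (Kt y) (Kt y) +
      2 * ρ * g.val y (Kt y) (Kφ y) + g.val y (Kφ y) (Kφ y) := fun y ↦ by
    simp only [rhoHat, map_add, map_smul, add_apply, smul_apply, smul_eq_mul,
      g.symm y (Kφ y) (Kt y)]
    ring
  have eω : ∀ y, g.val y (omegaHat Kt Kφ om y) (omegaHat Kt Kφ om y) = g.val y (Kt y) (Kt y) +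
      2 * om y * g.val y (Kt y) (Kφ y) + om y ^ 2 * g.val y (Kφ y) (Kφ y) := fun y ↦ by
    simp only [omegaHat, map_add, map_smul, add_apply, smul_apply, smul_eq_mul,
      g.symm y (Kφ y) (Kt y)]
    ring
  have h1 := (g.mdifferentiableAt_val ht ht).hasFDerivAt_comp_extChartAt_symm
  have h2 := (g.mdifferentiableAt_val ht hφ).hasFDerivAt_comp_extChartAt_symm
  have h3 := (g.mdifferentiableAt_val hφ hφ).hasFDerivAt_comp_extChartAt_symm
  have h4 := hom.hasFDerivAt_comp_extChartAt_symm
  obtain ⟨L, hL, hLn⟩ := hasFDerivAt_log_sqrt_div_sqrt h1 h2 h3 h4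
    (comp_extChartAt_symm_extChartAt _ x) (comp_extChartAt_symm_extChartAt _ x)
    (comp_extChartAt_symm_extChartAt _ x) (comp_extChartAt_symm_extChartAt _ x) (ρ := ρ)
    (by rwa [← eρ]) (by rwa [← eω]) hωφ
  have h5 := congrArg (fun L : E →L[ℝ] ℝ ↦ L n) (mvfderiv_of_hasFDerivAt_comp_extChartAt_symm
    (f := fun y ↦ Real.log (g.norm (rhoHat Kt Kφ ρ) y / g.norm (omegaHat Kt Kφ om) y)) (x := x)
    (hL.congr_of_eventuallyEq (Filter.Eventually.of_forall fun z ↦ by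
      simp only [PseudoRiemMetric.norm, eρ, eω, Function.comp_apply])))
  refine h5.trans ((hLn n).trans ?_)
  rw [eρ, eω]
  rfl

end ScalarFunctions

section

variable {E : Type*} [NormedAddCommGroup E] [NormedSpace ℝ E] [FiniteDimensional ℝ E]
  {M : Type*} [TopologicalSpace M] [ChartedSpace E M] [IsManifold 𝓘(ℝ, E) ∞ M]
  {F : Type*} [NormedAddCommGroup F] [NormedSpace ℝ F]
  {S : Type*} [TopologicalSpace S] [ChartedSpace F S] [IsManifold 𝓘(ℝ, F) ∞ S]

theorem modelSecondForm_add_smul {g : PseudoRiemMetric E M}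
    {D : TangentConnection E M} {f : S → M} (hf : ContMDiff 𝓘(ℝ, F) 𝓘(ℝ, E) ∞ f) {q : S}
    (hc : IsCompl (g.orth (tangentRange F f q)) (tangentRange F f q))
    {Γ : E →L[ℝ] E →L[ℝ] E} (hΓ : IsChristoffelAt D (f q) Γ) (a b : ℝ) (u v w : F) :
    modelSecondForm g D f q (a • u + b • v) w =
      a • modelSecondForm g D f q u w + b • modelSecondForm g D f q v w := by
  obtain ⟨h1, t, ht⟩ := (modelSecondForm_eq_iff hf hc rfl hΓ (u := u) (v := w)).1 rfl
  obtain ⟨h2, t', ht'⟩ := (modelSecondForm_eq_iff hf hc rfl hΓ (u := v) (v := w)).1 rfl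
  refine (modelSecondForm_eq_iff hf hc rfl hΓ).2 ⟨fun w ↦ ?_, a • t + b • t', ?_⟩
  · rw [map_add, map_smul, map_smul, add_apply, smul_apply, smul_apply, h1, h2, smul_zero,
      smul_zero, add_zero]
  · simp only [map_add, map_smul, add_apply, smul_apply]
    linear_combination (norm := module) a • ht + b • ht'

end

/-! ### Pointwise algebra of the principal curvatures -/

section LinearAlgebra

variable {E F F₂ : Type*} [NormedAddCommGroup E] [NormedSpace ℝ E] [NormedAddCommGroup F]
  [NormedSpace ℝ F] [NormedAddCommGroup F₂] [NormedSpace ℝ F₂]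

/-- The principal curvatures of a symmetric bilinear map `II`, restricted to a positive definite
subspace `range (A ∘ T)` orthogonal to `A (kt + o kφ)`, which is umbilic on the orthogonal
complement of `A (ρ kt + kφ)`. -/
theorem eigen_of_umbilic {B : E →L[ℝ] E →L[ℝ] ℝ} (hB : ∀ a b, B a b = B b a)
    {A : F →L[ℝ] E} {T : F₂ →L[ℝ] F} {II : F → F → E}
    (hlin : ∀ (a b : ℝ) (u v w : F), II (a • u + b • v) w = a • II u w + b • II v w)
    (hsymm : ∀ u v, II u v = II v u) {kt kφ : F} {H : E} {ρ o : ℝ}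
    (hpos : ∀ u, u ≠ 0 → 0 < B (A (T u)) (A (T u)))
    (hω : ∀ u, B (A kt + o • A kφ) (A (T u)) = 0)
    (hmix : ∀ v, B (A kt) (A v) = 0 → B (A kφ) (A v) = 0 → II kφ v = 0)
    (humb : ∀ u v, B (ρ • A kt + A kφ) (A u) = 0 → B (ρ • A kt + A kφ) (A v) = 0 →
      II u v = B (A u) (A v) • H)
    {w : F₂} (hw : T w = kφ) (hP : 0 < B (A kφ) (A kφ)) :
    (∀ v, II kφ (T v) = B (A kφ) (A (T v)) • (B (A kφ) (A kφ))⁻¹ • II kφ kφ) ∧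
    (∀ u, B (A kt) (A (T u)) = 0 → B (A kφ) (A (T u)) = 0 →
      ∀ v, II (T u) (T v) = B (A (T u)) (A (T v)) • H) ∧
    (∀ u c, u ≠ 0 → (∀ v, II (T u) (T v) = B (A (T u)) (A (T v)) • c) →
      c = (B (A kφ) (A kφ))⁻¹ • II kφ kφ ∨ c = H) := by
  set P := B (A kφ) (A kφ) with hPdef
  -- Orthogonality to `kt + o kφ` makes orthogonality to `kφ` imply orthogonality to `kt`, and so to
  -- `ρ kt + kφ`.
  have horth : ∀ u, B (A kφ) (A (T u)) = 0 → B (A kt) (A (T u)) = 0 := fun u hu ↦ by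
    have := hω u
    rwa [map_add, map_smul, add_apply, smul_apply, hu, smul_zero, add_zero] at this
  -- The component along `kφ` is split off; this stays inside the range of `T` because `kφ = T w`.
  have hdec : ∀ v, ∃ v', T v = (B (A kφ) (A (T v)) * P⁻¹) • kφ + (1 : ℝ) • T v' ∧
      B (A kφ) (A (T v')) = 0 := fun v ↦ by
    refine ⟨v - (B (A kφ) (A (T v)) * P⁻¹) • w, ?_, ?_⟩
    · rw [map_sub, map_smul, hw]
      module
    · rw [map_sub, map_smul, hw, map_sub, map_smul, map_sub, map_smul, smul_eq_mul, ← hPdef]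
      field_simp
      ring
  have h1 : ∀ v, II kφ (T v) = B (A kφ) (A (T v)) • P⁻¹ • II kφ kφ := fun v ↦ by
    obtain ⟨v', hv, hv'⟩ := hdec v
    have h0 := hmix (T v') (horth v' hv') hv'
    rw [hsymm] at h0
    rw [hsymm]
    conv_lhs => rw [hv]
    rw [hlin, h0, smul_zero, add_zero, smul_smul]
  have h2 : ∀ u, B (A kt) (A (T u)) = 0 → B (A kφ) (A (T u)) = 0 →
      ∀ v, II (T u) (T v) = B (A (T u)) (A (T v)) • H := fun u hu1 hu2 v ↦ by
    obtain ⟨v', hv, hv'⟩ := hdec v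
    have hρ : ∀ u, B (A kφ) (A (T u)) = 0 → B (ρ • A kt + A kφ) (A (T u)) = 0 := fun u hu ↦ by
      rw [map_add, map_smul, add_apply, smul_apply, hu, horth u hu, smul_zero, add_zero]
    rw [hsymm, hv, hlin, hmix _ hu1 hu2, hsymm, humb _ _ (hρ u hu2) (hρ v' hv'), map_add, map_smul,
      map_smul, map_add, map_smul, map_smul, hB (A (T u)) (A kφ), hu2]
    simp
  refine ⟨h1, h2, fun u c hu hc ↦ ?_⟩
  -- The eigenvalue equation is tested on `u` itself if `u` is orthogonal to `kφ`, and on `w`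
  -- otherwise; in either case the scalar product is nonzero and can be cancelled.
  by_cases h0 : B (A kφ) (A (T u)) = 0
  · right
    have := (hc u).symm.trans (h2 u (horth u h0) h0 u)
    exact smul_right_injective _ (hpos u hu).ne' this
  · left
    have := hc w
    rw [hw, hsymm, h1, hB (A (T u))] at this
    exact (smul_right_injective _ h0 this).symm

/-- `R, Q, P` are the Gram entries `tt, tφ, φφ`, the `x`'s are components of II along a normal
vector, and `y` is that of `H`. Hypothesis `h` is umbilicity on the Killing plane, and it determines
`y`. -/
theorem curvature_difference_eq {P Q R ρ o xtt xtφ xφφ y : ℝ} (hP : 0 < P)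
    (hdet : R * P - Q ^ 2 < 0) (ho : Q + o * P = 0) (hq : ρ ^ 2 * R + 2 * ρ * Q + P ≠ 0)
    (h : (ρ * Q + P) ^ 2 * xtt - 2 * (ρ * Q + P) * (ρ * R + Q) * xtφ + (ρ * R + Q) ^ 2 * xφφ =
      (R * P - Q ^ 2) * (ρ ^ 2 * R + 2 * ρ * Q + P) * y) :
    (ρ ^ 2 * -(2 * xtt) + 2 * ρ * -(2 * xtφ) + -(2 * xφφ)) / (2 * (ρ ^ 2 * R + 2 * ρ * Q + P)) -
      (-(2 * xtt) + 2 * o * -(2 * xtφ) + o ^ 2 * -(2 * xφφ)) / (2 * (R + 2 * o * Q + o ^ 2 * P)) =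
      y - P⁻¹ * xφφ := by
  obtain rfl : Q = -(o * P) := by linarith
  -- Here `d = ⟨ω̂, ω̂⟩`; after the substitution the Gram determinant is `d * P`.
  obtain ⟨d, rfl⟩ : ∃ d, R = d + o ^ 2 * P := ⟨R - o ^ 2 * P, by ring⟩
  have hd0 : d ≠ 0 := by rintro h0; rw [h0] at hdet; nlinarith
  obtain ⟨q, hqd⟩ : ∃ q, q = ρ ^ 2 * (d + o ^ 2 * P) + 2 * ρ * -(o * P) + P := ⟨_, rfl⟩
  rw [← hqd] at hq h ⊢
  have e : d + o ^ 2 * P + 2 * o * -(o * P) + o ^ 2 * P = d := by ring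
  have hy : y = ((ρ * -(o * P) + P) ^ 2 * xtt - 2 * (ρ * -(o * P) + P) *
      (ρ * (d + o ^ 2 * P) + -(o * P)) * xtφ + (ρ * (d + o ^ 2 * P) + -(o * P)) ^ 2 * xφφ) /
      (d * P * q) := by
    rw [h, eq_div_iff (by positivity)]
    ring
  rw [e, hy]
  field_simp
  rw [hqd]
  ring

end LinearAlgebra

/-! ### Principal curvatures of the spatial section and the master equation -/

theorem proposition6
    -- the spacetime `(M, g)` with its Levi-Civita connection
    {E : Type*} [NormedAddCommGroup E] [NormedSpace ℝ E] [FiniteDimensional ℝ E]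
    {M : Type*} [TopologicalSpace M] [ChartedSpace E M] [IsManifold 𝓘(ℝ, E) ∞ M]
    (g : PseudoRiemMetric E M) (hg : g.IsLorentzian)
    (D : TangentConnection E M) (hD : IsLeviCivita g D)
    (Kt Kφ : Π x : M, TangentSpace 𝓘(ℝ, E) x) (hK : IsStationaryAxisymmetric g D Kt Kφ)
    -- the impact parameter
    (ρ : ℝ)
    -- the submanifold `S`
    {F : Type*} [NormedAddCommGroup F] [NormedSpace ℝ F] [FiniteDimensional ℝ F]
    {S : Type*} [TopologicalSpace S] [ChartedSpace F S] [IsManifold 𝓘(ℝ, F) ∞ S]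
    (gS : PseudoRiemMetric F S) (hgS : gS.IsLorentzian)
    (ι : S → M) (hι : IsIsometricEmbedding gS g ι) (hinv : IsInvariantSubmanifold F ι Kt Kφ)
    (H : Π x : M, TangentSpace 𝓘(ℝ, E) x) (humb : IsTotallyUmbilicOnPerp F g D ι (rhoHat Kt Kφ ρ) H)
    -- the spatial slice `Σ`, orthogonal to `ω̂ = Kt + om Kφ`
    (om : M → ℝ) (hom : ContMDiff 𝓘(ℝ, E) 𝓘(ℝ, ℝ) ∞ om)
    {F₁ : Type*} [NormedAddCommGroup F₁] [NormedSpace ℝ F₁] [FiniteDimensional ℝ F₁]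
    {Sig : Type*} [TopologicalSpace Sig] [ChartedSpace F₁ Sig] [IsManifold 𝓘(ℝ, F₁) ∞ Sig]
    (gSig : PseudoRiemMetric F₁ Sig) (κ : Sig → M) (hκ : IsSpatialSlice gSig g κ Kφ (omegaHat Kt Kφ om))
   
    (DSig : TangentConnection F₁ Sig) (hDSig : IsLeviCivita gSig DSig)
    -- the spatial section `S' = S ∩ Σ`, as a submanifold of `Σ`
    {F₂ : Type*} [NormedAddCommGroup F₂] [NormedSpace ℝ F₂] [FiniteDimensional ℝ F₂]
    {S' : Type*} [TopologicalSpace S'] [ChartedSpace F₂ S'] [IsManifold 𝓘(ℝ, F₂) ∞ S']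
    (hdim : Module.finrank ℝ F₂ + 1 = Module.finrank ℝ F)
    (i : S' → Sig) (hi : Manifold.IsSmoothEmbedding 𝓘(ℝ, F₂) 𝓘(ℝ, F₁) ∞ i)
    (hsection : Set.range (κ ∘ i) = Set.range ι ∩ Set.range κ)
    -- `II(Kφ, X) = 0` for `X ∈ TS` orthogonal to the Killing fields, along `S'`
    (hmixed : ∀ q : S, ι q ∈ Set.range κ → ∀ u v : TangentSpace 𝓘(ℝ, F) q,
      diffl ι q u = Kφ (ι q) →
      g.val (ι q) (Kt (ι q)) (diffl ι q v) = 0 → g.val (ι q) (Kφ (ι q)) (diffl ι q v) = 0 →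
      secondFundamentalForm g D ι q u v = 0)
    -- a point of `S'` and an orthonormal frame of the normal space of `S` there
    (p : S') {k : ℕ} (ξ : Fin k → TangentSpace 𝓘(ℝ, E) (κ (i p)))
    (hξ : IsNormalFrame F g ι (κ (i p)) ξ) :
    ∃ lamφ lama : TangentSpace 𝓘(ℝ, F₁) (i p),
      -- the values of `λ_φ` and `λ_a`
      diffl κ (i p) lamφ =
        -((1 / 2 : ℝ) • normalDeriv g (κ (i p)) ξ
          (fun x ↦ Real.log (g.val x (Kφ x) (Kφ x)))) ∧
      diffl κ (i p) lama = H (κ (i p)) ∧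
      -- they are the principal curvatures of `S'` in `Σ`, in the direction of `Kφ` and in all
      -- directions orthogonal to the Killing fields, and there are no others
      (∃ u : TangentSpace 𝓘(ℝ, F₂) p, diffl (F := F₁) κ (i p) (diffl i p u) = Kφ (κ (i p)) ∧
        IsPrincipalCurvature gSig DSig i p u lamφ) ∧
      (∀ u : TangentSpace 𝓘(ℝ, F₂) p, u ≠ 0 →
        g.val (κ (i p)) (Kt (κ (i p))) (diffl (F := F₁) κ (i p) (diffl i p u)) = 0 →
        g.val (κ (i p)) (Kφ (κ (i p))) (diffl (F := F₁) κ (i p) (diffl i p u)) = 0 →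
        IsPrincipalCurvature gSig DSig i p u lama) ∧
      (∀ (u : TangentSpace 𝓘(ℝ, F₂) p) (c : TangentSpace 𝓘(ℝ, F₁) (i p)),
        IsPrincipalCurvature gSig DSig i p u c → c = lamφ ∨ c = lama) ∧
      -- the master equation, wherever `‖ρ̂‖ ≠ 0`
      (g.val (κ (i p)) (rhoHat Kt Kφ ρ (κ (i p))) (rhoHat Kt Kφ ρ (κ (i p))) ≠ 0 →
        diffl κ (i p) lama - diffl κ (i p) lamφ =
          normalDeriv g (κ (i p)) ξ
            (fun x ↦ Real.log (g.norm (rhoHat Kt Kφ ρ) x / g.norm (omegaHat Kt Kφ om) x))) := by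
  have hιs := hι.embedding.contMDiff
  have hκs := hκ.embedding.embedding.contMDiff
  have his := hi.contMDiff
  obtain ⟨s, hs, hsi⟩ := hι.embedding.exists_lift (hκs.comp his)
    (fun y ↦ (hsection.subset ⟨y, rfl⟩).1)
  have hx : ι (s p) = κ (i p) := congrFun hsi p
  have hinj : Function.Injective ι := hι.embedding.isEmbedding.injective
  have hc := PseudoRiemMetric.isCompl_orth_tangentRange hι (s p)
  have hc' := hκ.spacelike.isCompl_orth (tangentRange F₂ i p)
  obtain ⟨Γ, hΓs, hΓ⟩ := hD.exists_christoffel (κ (i p))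
  have hA := hι.injective_modelDiff (s p)
  have hC := hκ.embedding.injective_modelDiff (i p)
  have hI := hi.injective_modelDiff p
  have hcomp : ∀ u : F₂, modelDiff E F ι (s p) (modelDiff F F₂ s p u) =
      modelDiff E F₁ κ (i p) (modelDiff F₁ F₂ i p u) := fun u ↦ by
    have h1 := modelDiff_comp hιs hs p
    rw [hsi, modelDiff_comp hκs his p] at h1
    exact (congrArg (fun T : F₂ →L[ℝ] E ↦ T u) h1).symm
  -- the hypotheses at the point `κ (i p)`, in the model spaces
  obtain ⟨kt, hkt⟩ : ∃ a : F, modelDiff E F ι (s p) a = Kt (κ (i p)) :=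
    -- The points `ι (s p)` and `κ (i p)` are only propositionally equal, so the point is
    -- generalized before the hypothesis on `S` is transported.
    (show ∀ x, ι (s p) = x → ∃ a : F, modelDiff E F ι (s p) a = (Kt x : E) by
      rintro _ rfl
      exact hinv.tangent_t (s p)) _ hx
  obtain ⟨kφ, hkφ⟩ : ∃ a : F, modelDiff E F ι (s p) a = Kφ (κ (i p)) :=
    (show ∀ x, ι (s p) = x → ∃ a : F, modelDiff E F ι (s p) a = (Kφ x : E) by
      rintro _ rfl
      exact hinv.tangent_φ (s p)) _ hx
  have hmix : ∀ v, g.form (κ (i p)) (modelDiff E F ι (s p) kt) (modelDiff E F ι (s p) v) = 0 →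
      g.form (κ (i p)) (modelDiff E F ι (s p) kφ) (modelDiff E F ι (s p) v) = 0 →
      modelSecondForm g D ι (s p) kφ v = 0 := by
    rw [hkt, hkφ]
    exact (show ∀ x, ι (s p) = x → x ∈ Set.range κ → modelDiff E F ι (s p) kφ = Kφ x → ∀ v : F,
      g.form x (Kt x) (modelDiff E F ι (s p) v) = 0 →
      g.form x (Kφ x) (modelDiff E F ι (s p) v) = 0 → modelSecondForm g D ι (s p) kφ v = 0 by
        rintro _ rfl h1 h2 v h3 h4
        exact hmixed (s p) h1 kφ v h2 h3 h4) _ hx ⟨i p, rfl⟩ hkφ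
  obtain ⟨h₀, hh₀⟩ : ∃ h : E, h = H (κ (i p)) := ⟨_, rfl⟩
  have humb' : ∀ u v, g.form (κ (i p)) (ρ • modelDiff E F ι (s p) kt + modelDiff E F ι (s p) kφ)
      (modelDiff E F ι (s p) u) = 0 →
      g.form (κ (i p)) (ρ • modelDiff E F ι (s p) kt + modelDiff E F ι (s p) kφ)
        (modelDiff E F ι (s p) v) = 0 → modelSecondForm g D ι (s p) u v =
      g.form (κ (i p)) (modelDiff E F ι (s p) u) (modelDiff E F ι (s p) v) • h₀ := by
    rw [hkt, hkφ, hh₀]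
    exact (show ∀ x, ι (s p) = x → ∀ u v : F,
      g.form x (rhoHat Kt Kφ ρ x) (modelDiff E F ι (s p) u) = 0 →
      g.form x (rhoHat Kt Kφ ρ x) (modelDiff E F ι (s p) v) = 0 →
      modelSecondForm g D ι (s p) u v =
        g.form x (modelDiff E F ι (s p) u) (modelDiff E F ι (s p) v) • (H x : E) by
        rintro _ rfl u v h1 h2
        exact humb.umbilic (s p) u v h1 h2) _ hx
  have hHn : ∀ w, g.form (κ (i p)) h₀ (modelDiff E F ι (s p) w) = 0 := by
    rw [hh₀]
    exact (show ∀ x, ι (s p) = x → ∀ w : F, g.form x (H x) (modelDiff E F ι (s p) w) = 0 by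
      rintro _ rfl w
      exact g.mem_orth.1 (humb.normal (s p)) _ ⟨w, rfl⟩) _ hx
  have hdG : ∀ {X Y : Π x : M, TangentSpace 𝓘(ℝ, E) x} (_ : IsKilling g D X) (_ : IsKilling g D Y)
      (_ : ∀ q, X (ι q) ∈ tangentRange F ι q) (_ : ∀ q, Y (ι q) ∈ tangentRange F ι q) {a b : F}
      (_ : modelDiff E F ι (s p) a = X (κ (i p))) (_ : modelDiff E F ι (s p) b = Y (κ (i p)))
      {n : E} (_ : ∀ w, g.form (κ (i p)) n (modelDiff E F ι (s p) w) = 0),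
      mvfderiv 𝓘(ℝ, E) (fun y ↦ g.val y (X y) (Y y)) (κ (i p)) n =
        -(2 * g.form (κ (i p)) (modelSecondForm g D ι (s p) a b) n) :=
    fun hX hY hXt hYt _ _ ha hb _ hn ↦
      mvfderiv_val_eq_modelSecondForm hD hιs hc hA hx hX hY hXt hYt ha hb hn
  have hC1 : ∀ a : F₁, g.form (κ (i p)) (modelDiff E F ι (s p) (kt + om (κ (i p)) • kφ))
      (modelDiff E F₁ κ (i p) a) = 0 := fun a ↦ by
    have h1 : diffl κ (i p) a ∈ g.orth (Submodule.span ℝ {omegaHat Kt Kφ om (κ (i p))}) :=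
      hκ.orthogonal (i p) ▸ ⟨a, rfl⟩
    have h2 := g.mem_orth.1 h1 _ (Submodule.mem_span_singleton_self _)
    rw [map_add, map_smul, hkt, hkφ, g.form_symm]
    exact h2
  have hC2 : ∀ n : E, g.form (κ (i p)) (modelDiff E F ι (s p) (kt + om (κ (i p)) • kφ)) n = 0 →
      n ∈ Set.range (modelDiff E F₁ κ (i p)) := fun n hn ↦ by
    have h1 : n ∈ g.orth (Submodule.span ℝ {omegaHat Kt Kφ om (κ (i p))}) := by
      refine g.mem_orth.2 fun v hv ↦ ?_
      obtain ⟨r, rfl⟩ := Submodule.mem_span_singleton.1 hv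
      rw [map_add, map_smul, hkt, hkφ, g.form_symm] at hn
      exact (map_smul (g.val (κ (i p)) n) r _).trans (by
        rw [show g.val (κ (i p)) n (omegaHat Kt Kφ om (κ (i p))) = 0 from hn, smul_zero])
    rw [← hκ.orthogonal] at h1
    exact h1
  obtain ⟨fφ, hfφ⟩ : ∃ a : F₁, modelDiff E F₁ κ (i p) a = modelDiff E F ι (s p) kφ := by
    rw [hkφ]
    exact hκ.tangent_φ (i p)
  have hval : ∀ a b : F₁, g.form (κ (i p)) (modelDiff E F₁ κ (i p) a) (modelDiff E F₁ κ (i p) b) =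
    gSig.form (i p) a b := hκ.embedding.form_modelDiff rfl
  obtain ⟨R, hR⟩ : ∃ R, g.form (κ (i p)) (modelDiff E F ι (s p) kt) (modelDiff E F ι (s p) kt) = R :=
    ⟨_, rfl⟩
  obtain ⟨Q, hQ⟩ : ∃ Q, g.form (κ (i p)) (modelDiff E F ι (s p) kt) (modelDiff E F ι (s p) kφ) = Q :=
    ⟨_, rfl⟩
  obtain ⟨P, hP⟩ : ∃ P, g.form (κ (i p)) (modelDiff E F ι (s p) kφ) (modelDiff E F ι (s p) kφ) = P :=
    ⟨_, rfl⟩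
  have hgram : R * P - Q ^ 2 < 0 := by
    rw [← hR, ← hP, ← hQ, hkt, hkφ]
    exact hK.gram_neg (κ (i p))
  -- This is `⟨ω̂, Kφ⟩ = 0`, since `Kφ` is tangent to the slice.
  have hQP : Q + om (κ (i p)) * P = 0 := by
    have := hC1 fφ
    rwa [hfφ, map_add, map_smul, map_add, map_smul, add_apply, smul_apply, hP, hQ] at this
  have hP0 : 0 < P := by
    rw [← hP, ← hfφ, hval]
    refine hκ.spacelike (i p) fφ fun h0 ↦ ?_
    have h0' : fφ = (0 : F₁) := h0
    rw [h0', map_zero] at hfφ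
    rw [← hP, ← hQ, ← hfφ] at hgram
    simp at hgram
  -- In fact `⟨ω̂, ω̂⟩` is the Gram determinant divided by `P`.
  have hωω : g.form (κ (i p)) (modelDiff E F ι (s p) (kt + om (κ (i p)) • kφ))
      (modelDiff E F ι (s p) (kt + om (κ (i p)) • kφ)) ≠ 0 := by
    have e : g.form (κ (i p)) (modelDiff E F ι (s p) (kt + om (κ (i p)) • kφ))
        (modelDiff E F ι (s p) (kt + om (κ (i p)) • kφ)) =
          R + om (κ (i p)) * (Q + om (κ (i p)) * P) + om (κ (i p)) * Q := by
      simp only [map_add, map_smul, add_apply, smul_apply, hP, hQ, hR, smul_eq_mul,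
        g.form_symm _ (modelDiff E F ι (s p) kφ) (modelDiff E F ι (s p) kt)]
      ring
    rw [e, hQP]
    intro h0
    exact hgram.ne (by linear_combination P * h0 - Q * hQP)
  have hN : ∀ n : E, (∀ w, g.form (κ (i p)) n (modelDiff E F ι (s p) w) = 0) →
      n ∈ Set.range (modelDiff E F₁ κ (i p)) := fun n hn ↦ hC2 n (by rw [g.form_symm, hn])
  have hO : ∀ n : E, (∀ w, g.form (κ (i p)) n (modelDiff E F₁ κ (i p) w) = 0) →
      n ∈ Set.range (modelDiff E F ι (s p)) := by
    intro n hn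
    set W := modelDiff E F ι (s p) (kt + om (κ (i p)) • kφ) with hW
    -- After its component along `ω̂` is removed, `n` is both tangent and orthogonal to the slice,
    -- hence zero by nondegeneracy; so `n` is a multiple of `ω̂`.
    obtain ⟨a, ha⟩ := hC2 (n - (g.form (κ (i p)) W n / g.form (κ (i p)) W W) • W) (by
      rw [map_sub, map_smul, smul_eq_mul, div_mul_cancel₀ _ hωω, sub_self])
    have hab : ∀ b, gSig.form (i p) a b = 0 := fun b ↦ by
      rw [← hval, ha, map_sub, map_smul, sub_apply, smul_apply, hn, hC1, smul_zero, sub_zero]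
    have ha0 : a = 0 := gSig.nondegenerate (i p) a hab
    rw [ha0, map_zero] at ha
    exact ⟨(g.form (κ (i p)) W n / g.form (κ (i p)) W W) • (kt + om (κ (i p)) • kφ), by
      rw [map_smul, ← hW, ← sub_eq_zero.1 ha.symm]⟩
  have hT : ∀ a b, modelDiff E F₁ κ (i p) a = modelDiff E F ι (s p) b →
      a ∈ Set.range (modelDiff F₁ F₂ i p) := fun a b hab ↦
    mem_range_of_finrank_add_one hdim (A := (modelDiff E F ι (s p)).toLinearMap)
      (C := (modelDiff E F₁ κ (i p)).toLinearMap) (I := (modelDiff F₁ F₂ i p).toLinearMap)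
      (T := (modelDiff F F₂ s p).toLinearMap) hcomp hC hI (o := kt + om (κ (i p)) • kφ)
      (by
        rintro ⟨a, ha⟩
        have ha' : modelDiff E F₁ κ (i p) a = modelDiff E F ι (s p) (kt + om (κ (i p)) • kφ) := ha
        have h1 := hC1 a
        rw [ha'] at h1
        exact hωω h1) hab
  have hII := modelDiff_modelSecondForm hD hιs hDSig hκ.embedding his hs hsi hc hc' hN hO hT
  obtain ⟨uφ, huφ⟩ := hT fφ kφ hfφ
  have hsuφ : modelDiff F F₂ s p uφ = kφ := hA (by rw [hcomp, huφ, hfφ])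
  have hpos : ∀ u, u ≠ 0 → 0 < g.form (κ (i p)) (modelDiff E F ι (s p) (modelDiff F F₂ s p u))
      (modelDiff E F ι (s p) (modelDiff F F₂ s p u)) := fun u hu ↦ by
    rw [hcomp, hval]
    exact hκ.spacelike (i p) _ fun h0 ↦ hu (hI (h0.trans (map_zero _).symm))
  have hΓ' : IsChristoffelAt D (ι (s p)) Γ := by
    rw [hx]
    exact ⟨hΓs, hΓ⟩
  have hlin := modelSecondForm_add_smul hιs hc hΓ'
  have hsymm := modelSecondForm_symm hιs hc hΓ'
  have hIIn : ∀ u v w, g.form (κ (i p)) (modelSecondForm g D ι (s p) u v)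
      (modelDiff E F ι (s p) w) = 0 := fun u v ↦
    ((modelSecondForm_eq_iff hιs hc hx ⟨hΓs, hΓ⟩).1 rfl).1
  obtain ⟨e1, e2, e3⟩ := eigen_of_umbilic (g.form_symm (κ (i p))) hlin hsymm hpos
    (o := om (κ (i p))) (fun u ↦ by rw [hcomp, ← map_smul, ← map_add, hC1]) hmix humb' hsuφ
    (by rwa [hP])
  rw [hP] at e1 e3
  have hΛn : ∀ w, g.form (κ (i p)) (P⁻¹ • modelSecondForm g D ι (s p) kφ kφ)
      (modelDiff E F ι (s p) w) = 0 := fun w ↦ by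
    rw [map_smul, smul_apply, hIIn, smul_zero]
  obtain ⟨lamφ, hlamφ⟩ := hN _ hΛn
  obtain ⟨lama, hlama⟩ := hN _ hHn
  have hpc : ∀ {u : F₂} {c : F₁}, u ≠ 0 →
      (∀ w, g.form (κ (i p)) (modelDiff E F₁ κ (i p) c) (modelDiff E F ι (s p) w) = 0) →
      (∀ v, modelSecondForm g D ι (s p) (modelDiff F F₂ s p u) (modelDiff F F₂ s p v) =
        g.form (κ (i p)) (modelDiff E F ι (s p) (modelDiff F F₂ s p u))
          (modelDiff E F ι (s p) (modelDiff F F₂ s p v)) • modelDiff E F₁ κ (i p) c) →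
      IsPrincipalCurvature gSig DSig i p u c := by
    intro u c hu hc h
    have h1 : ∀ w, gSig.form (i p) c (modelDiff F₁ F₂ i p w) = 0 := fun w ↦ by
      rw [← hval, ← hcomp, hc]
    have h2 : ∀ v, modelSecondForm gSig DSig i p u v =
        gSig.form (i p) (modelDiff F₁ F₂ i p u) (modelDiff F₁ F₂ i p v) • c := fun v ↦ hC (by
      rw [hII, h, hcomp, hcomp, hval, map_smul])
    refine ⟨hu, gSig.mem_orth.2 ?_, h2⟩
    rintro _ ⟨w, rfl⟩
    exact h1 w
  have hpc' : ∀ {u : F₂} {c : F₁}, (∀ v, modelSecondForm gSig DSig i p u v =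
        gSig.form (i p) (modelDiff F₁ F₂ i p u) (modelDiff F₁ F₂ i p v) • c) → ∀ v,
      modelSecondForm g D ι (s p) (modelDiff F F₂ s p u) (modelDiff F F₂ s p v) =
        g.form (κ (i p)) (modelDiff E F ι (s p) (modelDiff F F₂ s p u))
          (modelDiff E F ι (s p) (modelDiff F F₂ s p v)) • modelDiff E F₁ κ (i p) c :=
    fun h v ↦ by rw [← hII, h, hcomp, hcomp, hval, map_smul]
  have e2' : ∀ u, g.form (κ (i p)) (Kt (κ (i p))) (modelDiff E F₁ κ (i p) (modelDiff F₁ F₂ i p u)) = 0 →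
      g.form (κ (i p)) (Kφ (κ (i p))) (modelDiff E F₁ κ (i p) (modelDiff F₁ F₂ i p u)) = 0 →
      ∀ v, modelSecondForm g D ι (s p) (modelDiff F F₂ s p u) (modelDiff F F₂ s p v) =
        g.form (κ (i p)) (modelDiff E F ι (s p) (modelDiff F F₂ s p u))
          (modelDiff E F ι (s p) (modelDiff F F₂ s p v)) • h₀ := fun u h1 h2 ↦
    e2 u (by rwa [hcomp, hkt]) (by rwa [hcomp, hkφ])
  have htd := IsSmoothField.isDiffFieldAt hK.killing_t.smooth
  have hφd := IsSmoothField.isDiffFieldAt hK.killing_φ.smooth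
  have hPφ : g.val (κ (i p)) (Kφ (κ (i p))) (Kφ (κ (i p))) = P := by
    rw [← hP, hkφ]
    rfl
  have hQtφ : g.val (κ (i p)) (Kt (κ (i p))) (Kφ (κ (i p))) = Q := by
    rw [← hQ, hkφ, hkt]
    rfl
  have hRt : g.val (κ (i p)) (Kt (κ (i p))) (Kt (κ (i p))) = R := by
    rw [← hR, hkt]
    rfl
  have hrho : g.val (κ (i p)) (rhoHat Kt Kφ ρ (κ (i p))) (rhoHat Kt Kφ ρ (κ (i p))) =
      ρ ^ 2 * R + 2 * ρ * Q + P := by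
    simp only [rhoHat, map_add, map_smul, add_apply, smul_apply, smul_eq_mul,
      g.symm _ (Kφ (κ (i p))) (Kt (κ (i p))), hPφ, hQtφ, hRt]
    ring
  have homega : g.val (κ (i p)) (omegaHat Kt Kφ om (κ (i p))) (omegaHat Kt Kφ om (κ (i p))) =
      R + 2 * om (κ (i p)) * Q + om (κ (i p)) ^ 2 * P := by
    simp only [omegaHat, map_add, map_smul, add_apply, smul_apply, smul_eq_mul,
      g.symm _ (Kφ (κ (i p))) (Kt (κ (i p))), hPφ, hQtφ, hRt]
    ring
  have humbn : ∀ n : E, (ρ * Q + P) ^ 2 * g.form (κ (i p)) (modelSecondForm g D ι (s p) kt kt) n -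
      2 * (ρ * Q + P) * (ρ * R + Q) * g.form (κ (i p)) (modelSecondForm g D ι (s p) kt kφ) n +
      (ρ * R + Q) ^ 2 * g.form (κ (i p)) (modelSecondForm g D ι (s p) kφ kφ) n =
      (R * P - Q ^ 2) * (ρ ^ 2 * R + 2 * ρ * Q + P) * g.form (κ (i p)) h₀ n := fun n ↦ by
    -- Up to scale, `z` is the combination of `Kt` and `Kφ` orthogonal to `ρ̂`. Its square `⟨z, z⟩`
    -- is the Gram determinant times `⟨ρ̂, ρ̂⟩`, so umbilicity on `(z, z)` gives the relation.
    set z := (ρ * Q + P) • kt + (-(ρ * R + Q)) • kφ with hz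
    have hAz : modelDiff E F ι (s p) z = (ρ * Q + P) • modelDiff E F ι (s p) kt +
        (-(ρ * R + Q)) • modelDiff E F ι (s p) kφ := by
      rw [hz, map_add, map_smul, map_smul]
    have hQ' := hQ
    rw [g.form_symm] at hQ'
    have hzρ : g.form (κ (i p)) (ρ • modelDiff E F ι (s p) kt + modelDiff E F ι (s p) kφ)
        (modelDiff E F ι (s p) z) = 0 := by
      rw [hAz]
      simp only [map_add, map_smul, add_apply, smul_apply, smul_eq_mul, hP, hQ, hQ', hR]
      ring
    have hzz : g.form (κ (i p)) (modelDiff E F ι (s p) z) (modelDiff E F ι (s p) z) =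
        (R * P - Q ^ 2) * (ρ ^ 2 * R + 2 * ρ * Q + P) := by
      rw [hAz]
      simp only [map_add, map_smul, add_apply, smul_apply, smul_eq_mul, hP, hQ, hQ', hR]
      ring
    have hlin2 : modelSecondForm g D ι (s p) z z =
        (ρ * Q + P) • ((ρ * Q + P) • modelSecondForm g D ι (s p) kt kt +
          (-(ρ * R + Q)) • modelSecondForm g D ι (s p) kt kφ) +
        (-(ρ * R + Q)) • ((ρ * Q + P) • modelSecondForm g D ι (s p) kt kφ +
          (-(ρ * R + Q)) • modelSecondForm g D ι (s p) kφ kφ) := by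
      rw [hz, hlin, hsymm kt, hsymm kφ, hlin, hlin, hsymm kφ kt]
    have h1 := congrArg (fun w : E ↦ g.form (κ (i p)) w n) ((humb' z z hzρ hzρ).symm.trans hlin2)
    simp only [hzz, map_add, map_smul, add_apply, smul_apply, smul_eq_mul] at h1
    linear_combination -h1
  refine ⟨lamφ, lama, ?_, hlama.trans hh₀, ⟨uφ, ?_, hpc ?_ ?_ ?_⟩, fun u hu h1 h2 ↦ hpc hu ?_ ?_,
    fun u c huc ↦ ?_, fun hρ ↦ ?_⟩
  · have h1 : (normalDeriv g (κ (i p)) ξ (fun x ↦ Real.log (g.val x (Kφ x) (Kφ x))) : E) =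
        (-2 : ℝ) • P⁻¹ • modelSecondForm g D ι (s p) kφ kφ := by
      refine hξ.normalDeriv_eq ((g.mem_orth_tangentAt hinj hx).2 fun w ↦ ?_) fun (n : E) hn ↦ ?_
      · rw [map_smul, smul_apply, hΛn, smul_zero]
      · have hn := (g.mem_orth_tangentAt hinj hx).1 hn
        refine (mvfderiv_log (g.mdifferentiableAt_val (hφd _) (hφd _)) ?_ n).trans ?_
        · exact (hPφ.trans_ne hP0.ne')
        · rw [hPφ, hdG hK.killing_φ hK.killing_φ hinv.tangent_φ hinv.tangent_φ hkφ hkφ hn]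
          change _ = g.form (κ (i p)) ((-2 : ℝ) • P⁻¹ • modelSecondForm g D ι (s p) kφ kφ) n
          rw [map_smul, map_smul, smul_apply, smul_apply, smul_eq_mul, smul_eq_mul]
          ring
    have h2 : P⁻¹ • modelSecondForm g D ι (s p) kφ kφ =
        -((1 / 2 : ℝ) • (-2 : ℝ) • P⁻¹ • modelSecondForm g D ι (s p) kφ kφ) := by module
    exact hlamφ.trans (h2.trans (congrArg (fun c : E ↦ -((1 / 2 : ℝ) • c)) h1.symm))
  · exact (congrArg (modelDiff E F₁ κ (i p)) huφ).trans (hfφ.trans hkφ)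
  · intro h0
    have h0' : uφ = (0 : F₂) := h0
    rw [← hP, ← hsuφ, h0', map_zero, map_zero, map_zero] at hP0
    exact hP0.ne rfl
  · rwa [hlamφ]
  · rw [hsuφ, hlamφ]
    exact e1
  · rwa [hlama]
  · rw [hlama]
    exact e2' u h1 h2
  · rcases e3 u _ huc.ne_zero (hpc' huc.eigen) with h2 | h2
    · exact Or.inl (hC (h2.trans hlamφ.symm))
    · exact Or.inr (hC (h2.trans hlama.symm))
  · have hρ' : ρ ^ 2 * R + 2 * ρ * Q + P ≠ 0 := by
      rwa [hrho] at hρ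
    symm
    have h1 : (normalDeriv g (κ (i p)) ξ (fun x ↦
        Real.log (g.norm (rhoHat Kt Kφ ρ) x / g.norm (omegaHat Kt Kφ om) x)) : E) =
        h₀ - P⁻¹ • modelSecondForm g D ι (s p) kφ kφ := by
      -- It suffices to compare both sides paired with a normal vector `n`; there all Gram
      -- derivatives become components of II.
      refine hξ.normalDeriv_eq ((g.mem_orth_tangentAt hinj hx).2 fun w ↦ ?_) fun (n : E) hn ↦ ?_
      · rw [map_sub, sub_apply, hΛn, hHn, sub_zero]
      · have hn := (g.mem_orth_tangentAt hinj hx).1 hn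
        refine (mvfderiv_log_norm_div_norm g (htd _) (hφd _) ρ (hom.mdifferentiable (by simp) _) hρ
          (homega.trans_ne ?_) ?_ n).trans ?_
        · exact fun h0 ↦ hgram.ne (by linear_combination P * h0 - (Q + om (κ (i p)) * P) * hQP)
        · rw [hQtφ, hPφ, hQP]
        · rw [hdG hK.killing_φ hK.killing_φ hinv.tangent_φ hinv.tangent_φ hkφ hkφ hn,
            hdG hK.killing_t hK.killing_φ hinv.tangent_t hinv.tangent_φ hkt hkφ hn,
            hdG hK.killing_t hK.killing_t hinv.tangent_t hinv.tangent_t hkt hkt hn, hrho, homega]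
          refine (curvature_difference_eq hP0 hgram hQP hρ' (humbn n)).trans ?_
          change _ = g.form (κ (i p)) (h₀ -
            P⁻¹ • modelSecondForm g D ι (s p) kφ kφ) n
          rw [map_sub, map_smul, sub_apply, smul_apply, smul_eq_mul]
    exact h1.trans (congrArg₂ (fun a b : E ↦ a - b) hlama hlamφ).symm
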